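/- \textbf{Model.} Fix $r\in(1,2)$, $\rho\in(1/2,1)$, $b\in\mathbb N$ with $b\ge 1$, $\alpha\in(1/2,1]$, $\eta\in(0,1]$, $\theta_0\in(0,1)$, and let $\gamma_n=\eta/(n+1)^\alpha$ for $n\ge 0$. In one round with propensity $\theta\in[0,1]$, a latent mode in $\{H,L\}$ shared by two sellers equals $H$ with probability $\theta$ and $L$ with probability $1-\theta$; given the mode, each of the two sellers independently plays the action equal to the mode with probability $\rho$ and the other action with probability $1-\rho$. A seller's profit $\Pi$ is $2r$, $r$, $2+r$, $2$ when (own action, opponent's action) is $(H,H)$, $(H,L)$, $(L,H)$, $(L,L)$, respectively. Let $S$ and $\Pi$ denote the action and profit of a uniformly chosen seller in the round, $p_H(\theta)=\mathbb P(S=H\mid\theta)=\theta\rho+(1-\theta)(1-\rho)$, $p_L(\theta)=1-p_H(\theta)$, and \[\Delta(\theta)=\mathbb E[\Pi\mid S=H,\theta]-\mathbb E[\Pi\mid S=L,\theta].\] Put $\sigma(z)=1/(1+e^{-z})$, $z_0=\log\frac{\theta_0}{1-\theta_0}$, and for $n\ge 0$ \[\theta_n=\sigma(z_n),\qquad z_{n+1}=z_n+\gamma_n\overline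 D_n,\qquad \overline D_n=\frac1{2b}\sum_{\ell=1}^b\sum_{i=1}^2\Bigl(\frac{\Pi_{n,i}^{(\ell)}}{p_H(\theta_n)}\mathbf 1\{S_{n,i}^{(\ell)}=H\}-\frac{\Pi_{n,i}^{(\ell)}}{p_L(\theta_n)}\mathbf 1\{S_{n,i}^{(\ell)}=L\}\Bigr),\] where $S_{n,i}^{(\ell)}$ and $\Pi_{n,i}^{(\ell)}$ are the action and profit of seller $i$ in round $\ell$ of batch $n$, and, conditionally on $\mathcal H_n=\sigma(z_0,\dots,z_n)$, the $b$ rounds of batch $n$ are independent, each distributed as a round with propensity $\theta_n$. Define \[\rho_c=\frac{1+\sqrt{(2-r)/r}}2,\qquad s=\frac{2(2-r)\rho(1-\rho)}{(r-1)(2\rho-1)^2},\qquad \theta_\pm=\frac12\pm\frac12\sqrt{1-s}\ \text{ if } s\le 1\] (one has $s<1$ when $\rho>\rho_c$). \textbf{Proposition (Convergence for Finite Batch Size).} There is a random variable $\theta_\infty$ such that $\theta_n\to\theta_\infty$ almost surely and, almost surely, $\theta_\infty$ is an equilibrium in $[0,1]$ of the ODE $\dot\theta=\theta(1-\theta)\Delta(\theta)$,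 i.e. $\theta_\infty\in[0,1]$ and $\theta_\infty(1-\theta_\infty)\Delta(\theta_\infty)=0$. Moreover: \begin{enumerate} \item[(i)] if $\rho<\rho_c$, then $\theta_\infty=0$ almost surely; \item[(ii)] if $\rho=\rho_c$, then $\theta_\infty\in\{0,1/2\}$ almost surely; \item[(iii)] if $\rho>\rho_c$, then $\theta_\infty\in\{0,\theta_+\}$ almost surely, and $\mathbb P(\theta_n\to 1)=\mathbb P(\theta_n\to\theta_-)=0$. \end{enumerate} -/

import Mathlib

open MeasureTheory ProbabilityTheory Filter Topology

noncomputable section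

namespace LLMPricing

/-- The two pricing strategies: high `H` and low `L`. The same type also records the latent mode
of the model (`H`-mode or `L`-mode). -/
inductive Price
  | H
  | L
  deriving DecidableEq

instance : Fintype Price where
  elems := {.H, .L}
  complete := by intro a; cases a <;> simp

instance : MeasurableSpace Price := ⊤

/-- Profit of a seller who plays `own` against an opponent who plays `opp`. -/
def payoff (r : ℝ) (own opp : Price) : ℝ :=
  match own, opp with
  | .H, .H => 2 * r
  | .H, .L => r
  | .L, .H => 2 + r
  | .L, .L => 2

/-- Profit of seller `i` under the strategy profile `s`; the opponent of `i` is `i.rev`. -/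
def profit (r : ℝ) (s : Fin 2 → Price) (i : Fin 2) : ℝ :=
  payoff r (s i) (s i.rev)

/-- Law of the shared latent mode: `H` with probability `θ`, `L` with probability `1 - θ`. -/
def modeProb (θ : ℝ) (m : Price) : ℝ :=
  match m with
  | .H => θ
  | .L => 1 - θ

/-- Conditional probability that a seller is recommended `a` when the latent mode is `m`. -/
def outputProb (ρ : ℝ) (m a : Price) : ℝ :=
  if a = m then ρ else 1 - ρ

/-- Probability of the strategy profile `s` in one round: the latent mode is shared, and given the
mode the two recommendations are independent. -/
def profileProb (ρ θ : ℝ) (s : Fin 2 → Price) : ℝ :=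
  ∑ m : Price, modeProb θ m * ∏ i : Fin 2, outputProb ρ m (s i)

/-- Marginal probability `p_a(θ)` that a given seller is recommended `a`. -/
def marginalProb (ρ θ : ℝ) (a : Price) : ℝ :=
  ∑ m : Price, modeProb θ m * outputProb ρ m a

/-- `E[Π | S = a, θ]`, where `S` and `Π` are the action and the profit, in one round, of a seller
`i` chosen uniformly at random: `E[Π 1{S = a}] / P(S = a)`. -/
def condProfit (ρ r θ : ℝ) (a : Price) : ℝ :=
  (∑ i : Fin 2, ∑ s : Fin 2 → Price,
      if s i = a then (1 / 2) * profileProb ρ θ s * profit r s i else 0) /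
    (∑ i : Fin 2, ∑ s : Fin 2 → Price,
      if s i = a then (1 / 2) * profileProb ρ θ s else 0)

/-- The conditional payoff difference `Δ(θ) = E[Π | S = H, θ] - E[Π | S = L, θ]`. -/
def payoffDiff (ρ r θ : ℝ) : ℝ :=
  condProfit ρ r θ .H - condProfit ρ r θ .L

/-- The inverse-probability-weighted estimator `D(θ)` computed from seller `i` in a round with
strategy profile `s`. -/
def ipwEstimator (ρ r θ : ℝ) (s : Fin 2 → Price) (i : Fin 2) : ℝ :=
  profit r s i / marginalProb ρ θ .H * (if s i = .H then 1 else 0) -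
    profit r s i / marginalProb ρ θ .L * (if s i = .L then 1 else 0)

/-- The average of the estimator over both sellers and the `b` rounds of a batch `x`. -/
def batchEstimator {b : ℕ} (ρ r θ : ℝ) (x : Fin b → Fin 2 → Price) : ℝ :=
  1 / (2 * (b : ℝ)) * ∑ l : Fin b, ∑ i : Fin 2, ipwEstimator ρ r θ (x l) i

/-- The step sizes `γ_n = η / (n + 1) ^ α`. -/
def stepSize (η α : ℝ) (n : ℕ) : ℝ :=
  η / ((n : ℝ) + 1) ^ α

/-- The log-odds `z_n` along a path of feedback data, `x n l i` being the action of seller `i` in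
round `l` of batch `n`: `z_0 = log (θ₀ / (1 - θ₀))` and `z_{n+1} = z_n + γ_n D̄_n`, where `D̄_n` is
computed from batch `n` at `θ_n = σ(z_n)`. -/
def logOdds {b : ℕ} (ρ r η α θ₀ : ℝ) (x : ℕ → Fin b → Fin 2 → Price) : ℕ → ℝ
  | 0 => Real.log (θ₀ / (1 - θ₀))
  | n + 1 => logOdds ρ r η α θ₀ x n +
      stepSize η α n * batchEstimator ρ r (Real.sigmoid (logOdds ρ r η α θ₀ x n)) (x n)

/-- The propensity `θ_n = σ(z_n)` along a path of feedback data. -/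
def propensity {b : ℕ} (ρ r η α θ₀ : ℝ) (x : ℕ → Fin b → Fin 2 → Price) (n : ℕ) : ℝ :=
  Real.sigmoid (logOdds ρ r η α θ₀ x n)

/-- The history `ℋ_n`, that is, the σ-algebra generated by `z_0, …, z_n`. -/
@[reducible]
def history {Ω : Type*} {b : ℕ} (ρ r η α θ₀ : ℝ) (S : ℕ → Ω → Fin b → Fin 2 → Price) (n : ℕ) :
    MeasurableSpace Ω :=
  ⨆ k ∈ Set.Iic n,
    MeasurableSpace.comap (fun ω => logOdds ρ r η α θ₀ (fun j => S j ω) k) inferInstance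

/-- `S n ω l i` is the random action of seller `i` in round `l` of batch `n`. Conditionally on the
history `ℋ_n`, the `b` rounds of batch `n` are independent, each with the one-round law at the
current propensity `θ_n`. -/
structure IsFeedbackProcess {Ω : Type*} [MeasurableSpace Ω] (P : Measure Ω) {b : ℕ}
    (ρ r η α θ₀ : ℝ) (S : ℕ → Ω → Fin b → Fin 2 → Price) : Prop where
  measurable : ∀ n, Measurable (S n)
  condLaw : ∀ (n : ℕ) (x : Fin b → Fin 2 → Price),
    P⟦S n ⁻¹' {x} | history ρ r η α θ₀ S n⟧ =ᵐ[P]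
      fun ω => ∏ l : Fin b, profileProb ρ (propensity ρ r η α θ₀ (fun j => S j ω) n) (x l)

/-- The right-hand side of the ODE `θ' = θ (1 - θ) Δ(θ)`. -/
def odeField (ρ r θ : ℝ) : ℝ :=
  θ * (1 - θ) * payoffDiff ρ r θ

/-- `θ ∈ [0, 1]` is an equilibrium of the ODE. -/
def IsEquilibrium (ρ r θ : ℝ) : Prop :=
  θ ∈ Set.Icc (0 : ℝ) 1 ∧ odeField ρ r θ = 0

/-- The critical fidelity `ρ_c(r)`. -/
def criticalFidelity (r : ℝ) : ℝ :=
  (1 + Real.sqrt ((2 - r) / r)) / 2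

/-- The statistic `s(ρ, r)`. -/
def fidelityStat (ρ r : ℝ) : ℝ :=
  2 * (2 - r) * (ρ * (1 - ρ)) / ((r - 1) * (2 * ρ - 1) ^ 2)

/-- The threshold `θ₊(ρ, r)`. -/
def thetaPlus (ρ r : ℝ) : ℝ :=
  1 / 2 + 1 / 2 * Real.sqrt (1 - fidelityStat ρ r)

/-- The threshold `θ₋(ρ, r)`. -/
def thetaMinus (ρ r : ℝ) : ℝ :=
  1 / 2 - 1 / 2 * Real.sqrt (1 - fidelityStat ρ r)

end LLMPricing

end

open LLMPricing

/-! In log-odds the dynamics read `z (n+1) = z n + γ n * Δ(σ(z n)) + ζ n`. The weights are bounded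
because each action has probability at least `1 - ρ` at every propensity, so `ζ n` is a martingale
difference of size `O(γ n)`. Its conditional variance is at least a fixed multiple of `γ n ^ 2`.
Since `∑ γ n ^ 2 < ∞`, the accumulated noise is an L²-bounded martingale and converges almost surely
(`IsBoundedNoise.ae_exists_tendsto_sum`).

Convergence is then pathwise and deterministic (`exists_tendsto_sigmoid`). Once the noise has
settled and the steps are small, the path cannot cross an interval where the drift has a strict sign
infinitely often in both directions. `Δ` vanishes identically on no interval, so the propensity
converges. Since `∑ γ n = ∞`, a finite limit of the log-odds must be a zero of the drift. The limit
`1` is impossible because `Δ(1) < 0` would send the log-odds to `-∞`.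

`Δ(θ)` has the sign of `θ(1-θ) - s/4`, so the interior zeros are none, `1/2`, or `θ₋ < θ₊`,
according to the position of `s` relative to `1`, equivalently of `ρ` relative to `ρ_c`.

What remains is to exclude `θ₋`, where the drift points away. The scale is `√T n`, with `T n` the
tail of `∑ γ n ^ 2`. From distance at least a multiple of `√T n`, all the remaining noise is too
weak to bring the path back with probability near one (Cantelli). From closer, nondegenerate noise
pushes it out to that distance with probability bounded below (second moments). So the conditional
probability of convergence to `θ₋` while staying nearby is eventually at most some `q < 1`
(`IsRepelled.measureReal_inter_le`), and Lévy's 0-1 law makes this event null. -/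

namespace LLMPricing

/-! ### One-round payoffs, the sign of `Δ`, and moments of the batch estimator -/

section Model

variable {ρ r θ : ℝ} {b : ℕ}

lemma sum_price (f : Price → ℝ) : ∑ a, f a = f .H + f .L := by
  change ∑ a ∈ ({.H, .L} : Finset Price), f a = _
  rw [Finset.sum_pair (by decide)]

lemma sum_profile (f : (Fin 2 → Price) → ℝ) :
    ∑ s, f s = f ![.H, .H] + f ![.H, .L] + f ![.L, .H] + f ![.L, .L] := by
  rw [← (finTwoArrowEquiv Price).symm.sum_comp, Fintype.sum_prod_type]
  simp only [sum_price, finTwoArrowEquiv_symm_apply]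
  ring

lemma marginalProb_H (ρ θ : ℝ) : marginalProb ρ θ .H = θ * ρ + (1 - θ) * (1 - ρ) := by
  simp [marginalProb, sum_price, modeProb, outputProb]

lemma marginalProb_L (ρ θ : ℝ) : marginalProb ρ θ .L = θ * (1 - ρ) + (1 - θ) * ρ := by
  simp [marginalProb, sum_price, modeProb, outputProb]

/-- Keeps the inverse-probability weights bounded uniformly in `θ`, even as `θ` approaches `0` or
`1`. -/
lemma one_sub_le_marginalProb (hρ : ρ ∈ Set.Ioo (1 / 2 : ℝ) 1) (hθ : θ ∈ Set.Icc (0 : ℝ) 1)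
    (a : Price) : 1 - ρ ≤ marginalProb ρ θ a := by
  obtain ⟨h1, h2⟩ := hρ
  obtain ⟨h3, h4⟩ := hθ
  cases a
  · rw [marginalProb_H]; nlinarith
  · rw [marginalProb_L]; nlinarith

lemma marginalProb_pos (hρ : ρ ∈ Set.Ioo (1 / 2 : ℝ) 1) (hθ : θ ∈ Set.Icc (0 : ℝ) 1)
    (a : Price) : 0 < marginalProb ρ θ a :=
  (by linarith [hρ.2] : 0 < 1 - ρ).trans_le (one_sub_le_marginalProb hρ hθ a)

lemma marginalProb_le_one (hρ : ρ ∈ Set.Ioo (1 / 2 : ℝ) 1) (hθ : θ ∈ Set.Icc (0 : ℝ) 1)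
    (a : Price) : marginalProb ρ θ a ≤ 1 := by
  obtain ⟨h1, h2⟩ := hρ
  obtain ⟨h3, h4⟩ := hθ
  cases a
  · rw [marginalProb_H]; nlinarith
  · rw [marginalProb_L]; nlinarith

lemma profileProb_eq (ρ θ : ℝ) (s : Fin 2 → Price) :
    profileProb ρ θ s = θ * (outputProb ρ .H (s 0) * outputProb ρ .H (s 1)) +
      (1 - θ) * (outputProb ρ .L (s 0) * outputProb ρ .L (s 1)) := by
  simp [profileProb, sum_price, modeProb, Fin.prod_univ_two]

lemma outputProb_nonneg (hρ : ρ ∈ Set.Ioo (1 / 2 : ℝ) 1) (m a : Price) : 0 ≤ outputProb ρ m a := by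
  unfold outputProb
  split_ifs <;> linarith [hρ.1, hρ.2]

lemma profileProb_nonneg (hρ : ρ ∈ Set.Ioo (1 / 2 : ℝ) 1) (hθ : θ ∈ Set.Icc (0 : ℝ) 1)
    (s : Fin 2 → Price) : 0 ≤ profileProb ρ θ s := by
  have h := outputProb_nonneg hρ
  have h0 := hθ.1
  have h1 : 0 ≤ 1 - θ := by linarith [hθ.2]
  rw [profileProb_eq]
  have := mul_nonneg (h .H (s 0)) (h .H (s 1))
  have := mul_nonneg (h .L (s 0)) (h .L (s 1))
  positivity

lemma sum_profileProb (ρ θ : ℝ) : ∑ s, profileProb ρ θ s = 1 := by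
  simp [sum_profile, profileProb_eq, outputProb]
  ring

lemma sq_le_profileProb_const (hρ : ρ ∈ Set.Ioo (1 / 2 : ℝ) 1) (hθ : θ ∈ Set.Icc (0 : ℝ) 1)
    (a : Price) : (1 - ρ) ^ 2 ≤ profileProb ρ θ (fun _ => a) := by
  obtain ⟨h1, h2⟩ := hρ
  obtain ⟨h3, h4⟩ := hθ
  have h5 : (1 - ρ) ^ 2 ≤ ρ ^ 2 := by nlinarith
  cases a <;> simp [profileProb_eq, outputProb] <;> nlinarith

/-- A mixed profile has probability `q = ρ(1-ρ)` under either mode, hence for every `θ`. The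
profiles `HH` and `LL` then have probabilities `p_H - q` and `p_L - q`, and only `p_H + p_L = 1` is
needed to combine the two conditional means. -/
lemma payoffDiff_eq (hρ : ρ ∈ Set.Ioo (1 / 2 : ℝ) 1) (hθ : θ ∈ Set.Icc (0 : ℝ) 1) :
    payoffDiff ρ r θ = 2 * (r - 1) -
      r * (ρ * (1 - ρ)) / (marginalProb ρ θ .H * marginalProb ρ θ .L) := by
  have hH := marginalProb_pos hρ hθ .H
  have hL := marginalProb_pos hρ hθ .L
  have dH : (∑ i : Fin 2, ∑ s : Fin 2 → Price,
      if s i = .H then (1 / 2) * profileProb ρ θ s else 0) = marginalProb ρ θ .H := by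
    simp [sum_profile, profileProb_eq, outputProb, Fin.sum_univ_two, marginalProb_H]; ring
  have dL : (∑ i : Fin 2, ∑ s : Fin 2 → Price,
      if s i = .L then (1 / 2) * profileProb ρ θ s else 0) = marginalProb ρ θ .L := by
    simp [sum_profile, profileProb_eq, outputProb, Fin.sum_univ_two, marginalProb_L]; ring
  have nH : (∑ i : Fin 2, ∑ s : Fin 2 → Price,
      if s i = .H then (1 / 2) * profileProb ρ θ s * profit r s i else 0) =
      r * (2 * marginalProb ρ θ .H - ρ * (1 - ρ)) := by
    simp [sum_profile, profileProb_eq, outputProb, Fin.sum_univ_two, marginalProb_H, profit,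
      payoff]
    ring
  have nL : (∑ i : Fin 2, ∑ s : Fin 2 → Price,
      if s i = .L then (1 / 2) * profileProb ρ θ s * profit r s i else 0) =
      2 * marginalProb ρ θ .L + r * (ρ * (1 - ρ)) := by
    simp [sum_profile, profileProb_eq, outputProb, Fin.sum_univ_two, marginalProb_L, profit,
      payoff]
    ring
  have hs : marginalProb ρ θ .L = 1 - marginalProb ρ θ .H := by
    rw [marginalProb_L, marginalProb_H]; ring
  unfold payoffDiff condProfit
  rw [dH, dL, nH, nL]
  rw [hs] at hL ⊢
  field_simp
  ring

/-- The payoff difference has the sign of `θ (1 - θ) - s / 4`. -/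
lemma payoffDiff_mul_eq (hr : r ∈ Set.Ioo (1 : ℝ) 2) (hρ : ρ ∈ Set.Ioo (1 / 2 : ℝ) 1)
    (hθ : θ ∈ Set.Icc (0 : ℝ) 1) :
    payoffDiff ρ r θ * (marginalProb ρ θ .H * marginalProb ρ θ .L) =
      2 * (r - 1) * (2 * ρ - 1) ^ 2 * (θ * (1 - θ) - fidelityStat ρ r / 4) := by
  have hH := marginalProb_pos hρ hθ .H
  have hL := marginalProb_pos hρ hθ .L
  have h1 : r - 1 ≠ 0 := by linarith [hr.1]
  have h2 : 2 * ρ - 1 ≠ 0 := by linarith [hρ.1]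
  rw [payoffDiff_eq hρ hθ, sub_mul, div_mul_cancel₀ _ (by positivity), fidelityStat,
    marginalProb_H, marginalProb_L]
  field_simp
  ring

/-- The factor `κ` may depend on `θ`: only signs and zeros of `Δ` are read off from this form. -/
lemma payoffDiff_factor (hr : r ∈ Set.Ioo (1 : ℝ) 2) (hρ : ρ ∈ Set.Ioo (1 / 2 : ℝ) 1)
    (hθ : θ ∈ Set.Icc (0 : ℝ) 1) :
    ∃ κ > 0, payoffDiff ρ r θ = κ * (θ * (1 - θ) - fidelityStat ρ r / 4) := by
  have hH := marginalProb_pos hρ hθ .H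
  have hL := marginalProb_pos hρ hθ .L
  have h1 : 0 < r - 1 := by linarith [hr.1]
  have h2 : 0 < 2 * ρ - 1 := by linarith [hρ.1]
  refine ⟨2 * (r - 1) * (2 * ρ - 1) ^ 2 / (marginalProb ρ θ .H * marginalProb ρ θ .L),
    by positivity, ?_⟩
  have := payoffDiff_mul_eq hr hρ hθ
  field_simp
  linarith

lemma fidelityStat_pos (hr : r ∈ Set.Ioo (1 : ℝ) 2) (hρ : ρ ∈ Set.Ioo (1 / 2 : ℝ) 1) :
    0 < fidelityStat ρ r := by
  have h1 : 0 < r - 1 := by linarith [hr.1]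
  have h2 : 0 < 2 * ρ - 1 := by linarith [hρ.1]
  have h3 : 0 < 2 - r := by linarith [hr.2]
  have h4 : 0 < 1 - ρ := by linarith [hρ.2]
  have h5 : 0 < ρ := by linarith
  unfold fidelityStat
  positivity

/-- Makes the threshold visible: `ρ_c` is the point where `2ρ - 1 = √((2-r)/r)`. -/
lemma one_sub_fidelityStat (hr : r ∈ Set.Ioo (1 : ℝ) 2) (hρ : ρ ∈ Set.Ioo (1 / 2 : ℝ) 1) :
    1 - fidelityStat ρ r =
      r / (2 * (r - 1) * (2 * ρ - 1) ^ 2) * ((2 * ρ - 1) ^ 2 - (2 - r) / r) := by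
  have h1 : r - 1 ≠ 0 := by linarith [hr.1]
  have h2 : 2 * ρ - 1 ≠ 0 := by linarith [hρ.1]
  have h3 : r ≠ 0 := by linarith [hr.1]
  unfold fidelityStat
  field_simp
  ring

lemma fidelityStat_compare (hr : r ∈ Set.Ioo (1 : ℝ) 2) (hρ : ρ ∈ Set.Ioo (1 / 2 : ℝ) 1) :
    (ρ < criticalFidelity r → 1 < fidelityStat ρ r) ∧
    (ρ = criticalFidelity r → fidelityStat ρ r = 1) ∧
    (criticalFidelity r < ρ → fidelityStat ρ r < 1) := by
  have h := one_sub_fidelityStat hr hρ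
  have h1 : 0 < r - 1 := by linarith [hr.1]
  have h2 : 0 < 2 * ρ - 1 := by linarith [hρ.1]
  have h0 : 0 < r := by linarith
  have h3 : 0 ≤ (2 - r) / r := div_nonneg (by linarith [hr.2]) h0.le
  have hk : 0 < r / (2 * (r - 1) * (2 * ρ - 1) ^ 2) := by positivity
  have hs := Real.sq_sqrt h3
  have hs0 := Real.sqrt_nonneg ((2 - r) / r)
  unfold criticalFidelity
  set w := Real.sqrt ((2 - r) / r)
  set κ := r / (2 * (r - 1) * (2 * ρ - 1) ^ 2)
  rw [← hs] at h
  refine ⟨fun hc => ?_, fun hc => ?_, fun hc => ?_⟩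
  · have : (2 * ρ - 1) ^ 2 - w ^ 2 < 0 := by nlinarith
    nlinarith
  · have : 2 * ρ - 1 = w := by linarith
    rw [this] at h
    linarith
  · have : 0 < (2 * ρ - 1) ^ 2 - w ^ 2 := by nlinarith
    nlinarith

lemma continuousOn_payoffDiff (hρ : ρ ∈ Set.Ioo (1 / 2 : ℝ) 1) :
    ContinuousOn (payoffDiff ρ r) (Set.Icc 0 1) := by
  have : ContinuousOn (fun θ => 2 * (r - 1) -
      r * (ρ * (1 - ρ)) / (marginalProb ρ θ .H * marginalProb ρ θ .L)) (Set.Icc 0 1) := by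
    refine continuousOn_const.sub (continuousOn_const.div ?_ fun θ hθ => ?_)
    · simp only [marginalProb_H, marginalProb_L]
      fun_prop
    · exact (mul_pos (marginalProb_pos hρ hθ .H) (marginalProb_pos hρ hθ .L)).ne'
  exact this.congr fun θ hθ => payoffDiff_eq hρ hθ

lemma profit_mem (hr : r ∈ Set.Ioo (1 : ℝ) 2) (s : Fin 2 → Price) (i : Fin 2) :
    0 ≤ profit r s i ∧ profit r s i ≤ 4 := by
  unfold profit
  cases s i <;> cases s i.rev <;> simp only [payoff] <;> constructor <;> linarith [hr.1, hr.2]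

lemma abs_ipwEstimator_le (hr : r ∈ Set.Ioo (1 : ℝ) 2) (hρ : ρ ∈ Set.Ioo (1 / 2 : ℝ) 1)
    (hθ : θ ∈ Set.Icc (0 : ℝ) 1) (s : Fin 2 → Price) (i : Fin 2) :
    |ipwEstimator ρ r θ s i| ≤ 4 / (1 - ρ) := by
  have h1 : 0 < 1 - ρ := by linarith [hρ.2]
  have hp := profit_mem hr s i
  have hb : ∀ a, |profit r s i / marginalProb ρ θ a| ≤ 4 / (1 - ρ) := by
    intro a
    rw [abs_of_nonneg (div_nonneg hp.1 (marginalProb_pos hρ hθ a).le)]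
    exact div_le_div₀ (by norm_num) hp.2 h1 (one_sub_le_marginalProb hρ hθ a)
  unfold ipwEstimator
  cases hs : s i
  · simpa using hb .H
  · simpa using hb .L

lemma abs_batchEstimator_le (hr : r ∈ Set.Ioo (1 : ℝ) 2) (hρ : ρ ∈ Set.Ioo (1 / 2 : ℝ) 1)
    (hb : 1 ≤ b) (hθ : θ ∈ Set.Icc (0 : ℝ) 1) (x : Fin b → Fin 2 → Price) :
    |batchEstimator ρ r θ x| ≤ 4 / (1 - ρ) := by
  have hb' : (0 : ℝ) < b := by exact_mod_cast hb
  unfold batchEstimator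
  rw [abs_mul, abs_of_pos (by positivity)]
  have : |∑ l : Fin b, ∑ i : Fin 2, ipwEstimator ρ r θ (x l) i| ≤ 2 * b * (4 / (1 - ρ)) := by
    refine (Finset.abs_sum_le_sum_abs _ _).trans ?_
    refine (Finset.sum_le_card_nsmul _ _ (2 * (4 / (1 - ρ))) fun l _ => ?_).trans ?_
    · refine (Finset.abs_sum_le_sum_abs _ _).trans ?_
      refine (Finset.sum_le_card_nsmul _ _ (4 / (1 - ρ)) fun i _ =>
        abs_ipwEstimator_le hr hρ hθ _ _).trans ?_
      simp
    · simp; linarith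
  calc _ ≤ 1 / (2 * (b : ℝ)) * (2 * b * (4 / (1 - ρ))) := by gcongr
    _ = _ := by field_simp

/-- Probability of the batch `x` when its rounds are independent with propensity `θ`. -/
def batchProb (ρ θ : ℝ) (x : Fin b → Fin 2 → Price) : ℝ :=
  ∏ l : Fin b, profileProb ρ θ (x l)

lemma batchProb_nonneg (hρ : ρ ∈ Set.Ioo (1 / 2 : ℝ) 1) (hθ : θ ∈ Set.Icc (0 : ℝ) 1)
    (x : Fin b → Fin 2 → Price) : 0 ≤ batchProb ρ θ x :=
  Finset.prod_nonneg fun l _ => profileProb_nonneg hρ hθ (x l)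

lemma sum_batchProb (ρ θ : ℝ) : ∑ x : Fin b → Fin 2 → Price, batchProb ρ θ x = 1 := by
  unfold batchProb
  rw [← Fintype.prod_sum (fun (_ : Fin b) s => profileProb ρ θ s)]
  simp [sum_profileProb]

lemma sum_batchProb_mul (ρ θ : ℝ) (f : (Fin 2 → Price) → ℝ) (l : Fin b) :
    ∑ x : Fin b → Fin 2 → Price, batchProb ρ θ x * f (x l) = ∑ s, profileProb ρ θ s * f s := by
  -- Padding `f` with factors `1` in the other rounds gives a product over rounds, so the sum
  -- factorizes and those rounds integrate to `1`.
  have e : ∀ x : Fin b → Fin 2 → Price, batchProb ρ θ x * f (x l) =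
      ∏ j, (profileProb ρ θ (x j) * if j = l then f (x j) else 1) := by
    intro x
    rw [Finset.prod_mul_distrib, Finset.prod_ite_eq' Finset.univ l (fun j => f (x j))]
    simp [batchProb]
  simp_rw [e]
  rw [← Fintype.prod_sum (fun j s => profileProb ρ θ s * if j = l then f s else 1),
    Finset.prod_eq_single l]
  · simp
  · intro j _ hj
    simp [hj, sum_profileProb]
  · simp

lemma sum_profileProb_mul_ipwEstimator (hρ : ρ ∈ Set.Ioo (1 / 2 : ℝ) 1)
    (hθ : θ ∈ Set.Icc (0 : ℝ) 1) (i : Fin 2) :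
    ∑ s, profileProb ρ θ s * ipwEstimator ρ r θ s i = payoffDiff ρ r θ := by
  have hH := marginalProb_pos hρ hθ .H
  have hL := marginalProb_pos hρ hθ .L
  have hs : marginalProb ρ θ .L = 1 - marginalProb ρ θ .H := by
    rw [marginalProb_L, marginalProb_H]; ring
  have eH : profileProb ρ θ ![.H, .H] = marginalProb ρ θ .H - ρ * (1 - ρ) := by
    simp [profileProb_eq, outputProb, marginalProb_H]; ring
  have eL : profileProb ρ θ ![.L, .L] = marginalProb ρ θ .L - ρ * (1 - ρ) := by
    simp [profileProb_eq, outputProb, marginalProb_L]; ring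
  have eHL : profileProb ρ θ ![.H, .L] = ρ * (1 - ρ) := by
    simp [profileProb_eq, outputProb]; ring
  have eLH : profileProb ρ θ ![.L, .H] = ρ * (1 - ρ) := by
    simp [profileProb_eq, outputProb]; ring
  rw [payoffDiff_eq hρ hθ, sum_profile, eH, eL, eHL, eLH]
  fin_cases i <;> simp [ipwEstimator, profit, payoff] <;> rw [hs] at hL ⊢ <;> field_simp <;> ring

/-- The batch estimator is unbiased for the payoff difference. -/
lemma sum_batchProb_mul_batchEstimator (hρ : ρ ∈ Set.Ioo (1 / 2 : ℝ) 1) (hb : 1 ≤ b)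
    (hθ : θ ∈ Set.Icc (0 : ℝ) 1) :
    ∑ x : Fin b → Fin 2 → Price, batchProb ρ θ x * batchEstimator ρ r θ x =
      payoffDiff ρ r θ := by
  have hb' : (b : ℝ) ≠ 0 := by exact_mod_cast (by omega : b ≠ 0)
  calc ∑ x : Fin b → Fin 2 → Price, batchProb ρ θ x * batchEstimator ρ r θ x
      = 1 / (2 * (b : ℝ)) * ∑ l : Fin b, ∑ i : Fin 2, ∑ x : Fin b → Fin 2 → Price,
          batchProb ρ θ x * ipwEstimator ρ r θ (x l) i := by
        simp only [batchEstimator, Finset.mul_sum]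
        rw [Finset.sum_comm]
        refine Finset.sum_congr rfl fun l _ => ?_
        rw [Finset.sum_comm]
        exact Finset.sum_congr rfl fun i _ => Finset.sum_congr rfl fun x _ => by ring
    _ = 1 / (2 * (b : ℝ)) * ∑ l : Fin b, ∑ i : Fin 2, payoffDiff ρ r θ := by
        congr 1
        refine Finset.sum_congr rfl fun l _ => Finset.sum_congr rfl fun i _ => ?_
        rw [sum_batchProb_mul ρ θ (fun s => ipwEstimator ρ r θ s i) l,
          sum_profileProb_mul_ipwEstimator hρ hθ]
    _ = payoffDiff ρ r θ := by
        simp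
        field_simp

lemma abs_payoffDiff_le (hr : r ∈ Set.Ioo (1 : ℝ) 2) (hρ : ρ ∈ Set.Ioo (1 / 2 : ℝ) 1)
    (hθ : θ ∈ Set.Icc (0 : ℝ) 1) : |payoffDiff ρ r θ| ≤ 4 / (1 - ρ) := by
  rw [← sum_profileProb_mul_ipwEstimator hρ hθ 0]
  refine (Finset.abs_sum_le_sum_abs _ _).trans ?_
  calc _ ≤ ∑ s, profileProb ρ θ s * (4 / (1 - ρ)) := by
        refine Finset.sum_le_sum fun s _ => ?_
        rw [abs_mul, abs_of_nonneg (profileProb_nonneg hρ hθ s)]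
        exact mul_le_mul_of_nonneg_left (abs_ipwEstimator_le hr hρ hθ s 0)
          (profileProb_nonneg hρ hθ s)
    _ = _ := by rw [← Finset.sum_mul, sum_profileProb, one_mul]

lemma batchEstimator_const (hb : 1 ≤ b) (a : Price) :
    batchEstimator ρ r θ (fun _ : Fin b => fun _ => a) = ipwEstimator ρ r θ (fun _ => a) 0 := by
  have hb' : (b : ℝ) ≠ 0 := by exact_mod_cast (by omega : b ≠ 0)
  have : ∀ i, ipwEstimator ρ r θ (fun _ => a) i = ipwEstimator ρ r θ (fun _ => a) 0 := fun _ => rfl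
  simp_rw [batchEstimator, this]
  simp
  field_simp

/-- Two batches suffice. All-`H` and all-`L` each have probability at least `((1-ρ)^2)^b`, and their
estimators are at least `2` and at most `-2`. Their squared distances to any common `m` therefore
add up to at least `4²/2 = 8`. -/
lemma le_sum_batchProb_mul_sq (hr : r ∈ Set.Ioo (1 : ℝ) 2) (hρ : ρ ∈ Set.Ioo (1 / 2 : ℝ) 1)
    (hb : 1 ≤ b) (hθ : θ ∈ Set.Icc (0 : ℝ) 1) (m : ℝ) :
    8 * ((1 - ρ) ^ 2) ^ b ≤
      ∑ x : Fin b → Fin 2 → Price, batchProb ρ θ x * (batchEstimator ρ r θ x - m) ^ 2 := by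
  set xH : Fin b → Fin 2 → Price := fun _ _ => .H
  set xL : Fin b → Fin 2 → Price := fun _ _ => .L
  have hne : xH ≠ xL := by
    intro h
    have := congrFun (congrFun h ⟨0, hb⟩) 0
    cases this
  have hnn : ∀ x : Fin b → Fin 2 → Price,
      0 ≤ batchProb ρ θ x * (batchEstimator ρ r θ x - m) ^ 2 :=
    fun x => mul_nonneg (batchProb_nonneg hρ hθ x) (sq_nonneg _)
  have hpair := Finset.sum_le_sum_of_subset_of_nonneg (Finset.subset_univ {xH, xL})
    (fun x _ _ => hnn x)
  rw [Finset.sum_pair hne] at hpair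
  have hp : ∀ a : Price, ((1 - ρ) ^ 2) ^ b ≤ batchProb ρ θ (fun _ : Fin b => fun _ => a) := by
    intro a
    simp only [batchProb, Finset.prod_const, Finset.card_univ, Fintype.card_fin]
    exact pow_le_pow_left₀ (sq_nonneg _) (sq_le_profileProb_const hρ hθ a) b
  have hH : 2 ≤ batchEstimator ρ r θ xH := by
    rw [batchEstimator_const hb]
    simp only [ipwEstimator, profit, payoff]
    simp
    rw [le_div_iff₀ (marginalProb_pos hρ hθ .H)]
    nlinarith [marginalProb_le_one hρ hθ .H, hr.1]
  have hL : batchEstimator ρ r θ xL ≤ -2 := by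
    rw [batchEstimator_const hb]
    simp only [ipwEstimator, profit, payoff]
    simp
    rw [le_div_iff₀ (marginalProb_pos hρ hθ .L)]
    nlinarith [marginalProb_le_one hρ hθ .L, hr.1]
  refine le_trans ?_ hpair
  have h1 := mul_le_mul_of_nonneg_right (hp .H) (sq_nonneg (batchEstimator ρ r θ xH - m))
  have h2 := mul_le_mul_of_nonneg_right (hp .L) (sq_nonneg (batchEstimator ρ r θ xL - m))
  have h3 : 8 ≤ (batchEstimator ρ r θ xH - m) ^ 2 + (batchEstimator ρ r θ xL - m) ^ 2 := by
    nlinarith [sq_nonneg (batchEstimator ρ r θ xH - m + (batchEstimator ρ r θ xL - m))]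
  have h4 : 0 ≤ ((1 - ρ) ^ 2) ^ b := by positivity
  nlinarith

end Model

/-! ### Deterministic recursions with convergent noise -/

section Recursion

variable {z N γ : ℕ → ℝ} {g : ℝ → ℝ} {C : ℝ}

/-- A perturbed recursion with convergent noise does not cross downwards, infinitely often, an
interval on which the drift is nonnegative. -/
lemma eventually_ge_or_le_of_nonneg
    (hrec : ∀ n, z (n + 1) = z n + γ n * g (z n) + (N (n + 1) - N n)) {L : ℝ}
    (hN : Tendsto N atTop (𝓝 L)) (hγ : ∀ n, 0 ≤ γ n) (hγ0 : Tendsto γ atTop (𝓝 0))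
    (hg : ∀ x, |g x| ≤ C) {a b : ℝ} (hab : a < b) (hpos : ∀ x ∈ Set.Ioo a b, 0 ≤ g x) :
    (∀ᶠ n in atTop, a ≤ z n) ∨ ∀ᶠ n in atTop, z n ≤ b := by
  obtain ⟨h, hh⟩ : ∃ h, h = (b - a) / 4 := ⟨_, rfl⟩
  have hh0 : 0 < h := by rw [hh]; linarith
  have e1 : ∀ᶠ n in atTop, |N n - L| < h := by
    have := Metric.tendsto_nhds.1 hN h hh0
    simpa [Real.dist_eq] using this
  have e2 : ∀ᶠ n in atTop, γ n * C < h := by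
    have : Tendsto (fun n => γ n * C) atTop (𝓝 0) := by simpa using hγ0.mul_const C
    exact this.eventually (gt_mem_nhds hh0)
  obtain ⟨n₀, hn₀⟩ := eventually_atTop.1 (e1.and e2)
  -- Absorbing the remaining noise leaves a recursion driven by the drift alone, within `h` of `z`
  -- after `n₀`.
  set w : ℕ → ℝ := fun n => z n + (L - N n) with hw
  have hwrec : ∀ n, w (n + 1) = w n + γ n * g (z n) := fun n => by
    simp only [hw]; rw [hrec n]; ring
  -- Below `a + 3h`, `z` lies in `(a, b)` and the drift cannot decrease `w`. Above it, one step
  -- loses less than `h`.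
  have trap : ∀ n ≥ n₀, a + 2 * h ≤ w n → a + 2 * h ≤ w (n + 1) := by
    intro n hn hwn
    obtain ⟨h1, h2⟩ := hn₀ n hn
    rw [hwrec]
    have h1' := abs_lt.1 h1
    rcases lt_or_ge (w n) (a + 3 * h) with hlt | hge
    · have := mul_nonneg (hγ n) (hpos (z n) ⟨by simp only [hw] at hwn; linarith,
        by simp only [hw] at hlt; linarith⟩)
      linarith
    · have h3 : |γ n * g (z n)| ≤ γ n * C := by
        rw [abs_mul, abs_of_nonneg (hγ n)]; exact mul_le_mul_of_nonneg_left (hg _) (hγ n)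
      linarith [(abs_le.1 h3).1]
  by_cases hex : ∃ n ≥ n₀, a + 2 * h ≤ w n
  · obtain ⟨n, hn, hwn⟩ := hex
    left
    have hall : ∀ k ≥ n, a + 2 * h ≤ w k := fun k hk => by
      induction k, hk using Nat.le_induction with
      | base => exact hwn
      | succ k hk ih => exact trap k (hn.trans hk) ih
    refine eventually_atTop.2 ⟨n, fun k hk => ?_⟩
    have h1 := abs_lt.1 (hn₀ k (hn.trans hk)).1
    have h2 := hall k hk
    simp only [hw] at h2
    linarith
  · push Not at hex
    right
    refine eventually_atTop.2 ⟨n₀, fun k hk => ?_⟩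
    have h1 := abs_lt.1 (hn₀ k hk).1
    have h2 := hex k hk
    simp only [hw] at h2
    linarith

/-- By continuity the drift keeps its sign on a subinterval around `x`; a negative sign is handled
by reflecting `z`. -/
lemma eventually_ge_or_le_of_ne_zero
    (hrec : ∀ n, z (n + 1) = z n + γ n * g (z n) + (N (n + 1) - N n)) {L : ℝ}
    (hN : Tendsto N atTop (𝓝 L)) (hγ : ∀ n, 0 ≤ γ n) (hγ0 : Tendsto γ atTop (𝓝 0))
    (hg : ∀ x, |g x| ≤ C) (hgc : Continuous g) {a b x : ℝ} (hx : x ∈ Set.Ioo a b)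
    (hgx : g x ≠ 0) :
    (∀ᶠ n in atTop, a ≤ z n) ∨ ∀ᶠ n in atTop, z n ≤ b := by
  rcases hgx.lt_or_gt with hneg | hpos
  · obtain ⟨l, u, ⟨hl, hu⟩, hlu⟩ := mem_nhds_iff_exists_Ioo_subset.1
      ((hgc.continuousAt.eventually (gt_mem_nhds hneg)).and (Ioo_mem_nhds hx.1 hx.2))
    have h1 := eventually_ge_or_le_of_nonneg (z := fun n => -z n) (N := fun n => -N n)
      (g := fun y => -g (-y)) (C := C) (a := -min u b) (b := -max l a)
      (fun n => by rw [hrec n, neg_neg]; ring) hN.neg hγ hγ0 (fun y => by simpa using hg (-y))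
      (neg_lt_neg ((max_lt hl hx.1).trans (lt_min hu hx.2)))
      (fun y hy => by
        have hm : -y ∈ Set.Ioo l u := ⟨by linarith [hy.2, le_max_left l a],
          by linarith [hy.1, min_le_left u b]⟩
        have := (hlu hm).1
        linarith)
    rcases h1 with h | h
    · exact Or.inr (h.mono fun n hn => by linarith [min_le_right u b])
    · exact Or.inl (h.mono fun n hn => by linarith [le_max_right l a])
  · obtain ⟨l, u, ⟨hl, hu⟩, hlu⟩ := mem_nhds_iff_exists_Ioo_subset.1
      ((hgc.continuousAt.eventually (lt_mem_nhds hpos)).and (Ioo_mem_nhds hx.1 hx.2))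
    have h1 := eventually_ge_or_le_of_nonneg hrec hN hγ hγ0 hg (a := max l a) (b := min u b)
      ((max_lt hl hx.1).trans (lt_min hu hx.2))
      (fun y hy => by
        have hm : y ∈ Set.Ioo l u := ⟨(le_max_left l a).trans_lt hy.1,
          hy.2.trans_le (min_le_left u b)⟩
        exact (hlu hm).1.le)
    rcases h1 with h | h
    · exact Or.inl (h.mono fun n hn => (le_max_right l a).trans hn)
    · exact Or.inr (h.mono fun n hn => hn.trans (min_le_right u b))

lemma tendsto_atTop_of_drift {w u : ℕ → ℝ} (hw : ∀ n, w (n + 1) = w n + γ n * u n)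
    (hγ : ∀ n, 0 ≤ γ n) (hγsum : Tendsto (fun n => ∑ k ∈ Finset.range n, γ k) atTop atTop)
    {κ : ℝ} (hκ : 0 < κ) (hu : ∀ᶠ n in atTop, κ ≤ u n) : Tendsto w atTop atTop := by
  obtain ⟨m, hm⟩ := eventually_atTop.1 hu
  have hle : ∀ n ≥ m, κ * ∑ k ∈ Finset.range n, γ k + (w m - κ * ∑ k ∈ Finset.range m, γ k) ≤
      w n := fun n hn => by
    induction n, hn using Nat.le_induction with
    | base => linarith
    | succ n hn ih =>
      rw [hw, Finset.sum_range_succ]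
      nlinarith [mul_le_mul_of_nonneg_left (hm n hn) (hγ n)]
  exact tendsto_atTop_mono' _ (eventually_atTop.2 ⟨m, hle⟩)
    (tendsto_atTop_add_const_right _ _ (hγsum.const_mul_atTop hκ))

/-- A nonzero limiting drift, summed against divergent step sizes, would send `w` to infinity. -/
lemma eq_zero_of_tendsto_of_drift {w u : ℕ → ℝ} (hw : ∀ n, w (n + 1) = w n + γ n * u n)
    (hγ : ∀ n, 0 ≤ γ n) (hγsum : Tendsto (fun n => ∑ k ∈ Finset.range n, γ k) atTop atTop)
    {L W : ℝ} (hu : Tendsto u atTop (𝓝 L)) (hW : Tendsto w atTop (𝓝 W)) : L = 0 := by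
  by_contra hL
  rcases lt_or_gt_of_ne hL with hneg | hpos
  · have := tendsto_atTop_of_drift (w := fun n => -w n) (u := fun n => -u n)
      (fun n => by rw [hw]; ring) hγ hγsum (κ := -L / 2) (by linarith)
      ((hu.neg.eventually (lt_mem_nhds (by linarith : -L / 2 < -L))).mono fun _ h => h.le)
    exact not_tendsto_nhds_of_tendsto_atTop this _ hW.neg
  · have := tendsto_atTop_of_drift hw hγ hγsum (κ := L / 2) (by linarith)
      ((hu.eventually (lt_mem_nhds (by linarith : L / 2 < L))).mono fun _ h => h.le)
    exact not_tendsto_nhds_of_tendsto_atTop this _ hW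

end Recursion

lemma exists_sigmoid_eq {t : ℝ} (ht : t ∈ Set.Ioo (0 : ℝ) 1) : ∃ x, Real.sigmoid x = t := by
  have : t ∈ Set.range Real.sigmoid := by rw [Real.range_sigmoid]; exact ht
  exact this

lemma tendsto_of_tendsto_sigmoid {ι : Type*} {l : Filter ι} {z : ι → ℝ} {x : ℝ}
    (h : Tendsto (fun n => Real.sigmoid (z n)) l (𝓝 (Real.sigmoid x))) :
    Tendsto z l (𝓝 x) := by
  refine tendsto_order.2 ⟨fun a ha => ?_, fun a ha => ?_⟩
  · exact (h.eventually (lt_mem_nhds (Real.sigmoid_lt ha))).mono fun _ => Real.sigmoid_lt_iff.1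
  · exact (h.eventually (gt_mem_nhds (Real.sigmoid_lt ha))).mono fun _ => Real.sigmoid_lt_iff.1

lemma sigmoid_mem_Icc (x : ℝ) : Real.sigmoid x ∈ Set.Icc (0 : ℝ) 1 :=
  ⟨Real.sigmoid_nonneg x, Real.sigmoid_le_one x⟩

/-- Convergence of the propensity along a path on which the accumulated noise converges. -/
theorem exists_tendsto_sigmoid {z N γ : ℕ → ℝ} {G : ℝ → ℝ} {C : ℝ}
    (hrec : ∀ n, z (n + 1) = z n + γ n * G (Real.sigmoid (z n)) + (N (n + 1) - N n))
    (hN : ∃ L, Tendsto N atTop (𝓝 L)) (hγ : ∀ n, 0 ≤ γ n) (hγ0 : Tendsto γ atTop (𝓝 0))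
    (hγsum : Tendsto (fun n => ∑ k ∈ Finset.range n, γ k) atTop atTop)
    (hGc : ContinuousOn G (Set.Icc 0 1)) (hG : ∀ t ∈ Set.Icc (0 : ℝ) 1, |G t| ≤ C)
    (hG1 : G 1 < 0)
    (hGz : ∀ s t, 0 < s → s < t → t < 1 → ∃ x ∈ Set.Ioo s t, G x ≠ 0) :
    ∃ θ, Tendsto (fun n => Real.sigmoid (z n)) atTop (𝓝 θ) ∧
      (θ = 0 ∨ θ ∈ Set.Ioo (0 : ℝ) 1 ∧ G θ = 0) := by
  obtain ⟨L, hN⟩ := hN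
  set g : ℝ → ℝ := fun x => G (Real.sigmoid x) with hgdef
  have hgc : Continuous g := hGc.comp_continuous continuous_sigmoid sigmoid_mem_Icc
  have hgC : ∀ x, |g x| ≤ C := fun x => hG _ (sigmoid_mem_Icc x)
  have hconv : ∃ θ, Tendsto (fun n => Real.sigmoid (z n)) atTop (𝓝 θ) := by
    refine tendsto_of_no_upcrossings (s := Set.univ) dense_univ ?_
      ⟨1, eventually_map.2 (Eventually.of_forall fun n => Real.sigmoid_le_one _)⟩
      ⟨0, eventually_map.2 (Eventually.of_forall fun n => Real.sigmoid_nonneg _)⟩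
    rintro s - t - hst ⟨hs, ht⟩
    have hs0 : 0 < s := by
      obtain ⟨n, hn⟩ := hs.exists
      exact (Real.sigmoid_pos _).trans hn
    have ht1 : t < 1 := by
      obtain ⟨n, hn⟩ := ht.exists
      exact hn.trans (Real.sigmoid_lt_one _)
    obtain ⟨x, hx, hGx⟩ := hGz s t hs0 hst ht1
    obtain ⟨a, rfl⟩ := exists_sigmoid_eq ⟨hs0, hst.trans ht1⟩
    obtain ⟨b, rfl⟩ := exists_sigmoid_eq ⟨hs0.trans hst, ht1⟩
    obtain ⟨y, rfl⟩ := exists_sigmoid_eq ⟨hs0.trans hx.1, hx.2.trans ht1⟩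
    rcases eventually_ge_or_le_of_ne_zero (g := g) hrec hN hγ hγ0 hgC hgc
      (x := y) ⟨Real.sigmoid_lt_iff.1 hx.1, Real.sigmoid_lt_iff.1 hx.2⟩ hGx with h | h
    · exact hs (h.mono fun n hn => not_lt.2 (Real.sigmoid_le hn))
    · exact ht (h.mono fun n hn => not_lt.2 (Real.sigmoid_le hn))
  obtain ⟨θ, hθ⟩ := hconv
  refine ⟨θ, hθ, ?_⟩
  have hmem : θ ∈ Set.Icc (0 : ℝ) 1 :=
    isClosed_Icc.mem_of_tendsto hθ (Eventually.of_forall fun n => sigmoid_mem_Icc _)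
  have hwrec : ∀ n, z (n + 1) - N (n + 1) = z n - N n + γ n * g (z n) := fun n => by
    rw [hrec n]; ring
  have hgθ : Tendsto (fun n => g (z n)) atTop (𝓝 (G θ)) :=
    ((hGc θ hmem).tendsto).comp (tendsto_nhdsWithin_iff.2
      ⟨hθ, Eventually.of_forall fun n => sigmoid_mem_Icc _⟩)
  rcases hmem.1.eq_or_lt with h0 | h0
  · exact Or.inl h0.symm
  rcases hmem.2.eq_or_lt with h1 | h1
  -- At the limit `1` the drift is eventually below `G 1 / 2 < 0`, so `z` tends to `-∞` and the
  -- propensity to `0`.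
  · exfalso
    subst h1
    have h2 := tendsto_atTop_of_drift (w := fun n => -(z n - N n)) (u := fun n => -g (z n))
      (fun n => by rw [hwrec]; ring) hγ hγsum (κ := -G 1 / 2) (by linarith)
      ((hgθ.neg.eventually (lt_mem_nhds (by linarith : -G 1 / 2 < -G 1))).mono fun _ h => h.le)
    have h3 : Tendsto (fun n => z n) atTop atBot := by
      have h4 := tendsto_neg_atTop_atBot.comp h2
      have h5 := h4.atBot_add hN
      refine h5.congr fun n => ?_
      simp
    have h6 := Real.tendsto_sigmoid_atBot.comp h3
    exact zero_ne_one (tendsto_nhds_unique h6 hθ)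
  · obtain ⟨x, rfl⟩ := exists_sigmoid_eq ⟨h0, h1⟩
    exact Or.inr ⟨⟨h0, h1⟩, eq_zero_of_tendsto_of_drift hwrec hγ hγsum hgθ
      ((tendsto_of_tendsto_sigmoid hθ).sub hN)⟩

/-- A bounded martingale difference sequence at scale `γ`, with conditional variance bounded below
at the scale `γ ^ 2`. -/
structure IsBoundedNoise {Ω : Type*} {m0 : MeasurableSpace Ω} (P : Measure Ω)
    (ℱ : Filtration ℕ m0) (γ : ℕ → ℝ) (C c : ℝ) (ζ : ℕ → Ω → ℝ) : Prop where
  measurable : ∀ n, Measurable[ℱ (n + 1)] (ζ n)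
  bound : ∀ n ω, |ζ n ω| ≤ C * γ n
  condExp_eq_zero : ∀ n, P[ζ n | ℱ n] =ᵐ[P] 0
  le_condExp_sq : ∀ n, (fun _ => c * γ n ^ 2) ≤ᵐ[P] P[fun ω => ζ n ω ^ 2 | ℱ n]

/-! ### Moment estimates for bounded martingale noise -/

section Noise

variable {Ω : Type*} {m0 : MeasurableSpace Ω} {P : Measure Ω} [IsProbabilityMeasure P]
  {ℱ : Filtration ℕ m0} {γ : ℕ → ℝ} {C c : ℝ} {ζ : ℕ → Ω → ℝ}

lemma integrableOn_of_abs_le {f : Ω → ℝ} {B : Set Ω} {K : ℝ} (hf : Measurable f)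
    (hB : MeasurableSet B) (h : ∀ ω ∈ B, |f ω| ≤ K) : IntegrableOn f B P :=
  Measure.integrableOn_of_bounded (measure_ne_top P B) hf.aestronglyMeasurable
    ((ae_restrict_iff' hB).2 (ae_of_all _ h))

lemma integrable_of_abs_le {f : Ω → ℝ} {K : ℝ} (hf : Measurable f) (h : ∀ ω, |f ω| ≤ K) :
    Integrable f P :=
  Integrable.of_bound hf.aestronglyMeasurable K (ae_of_all _ h)

lemma setIntegral_le_of_abs_le {f : Ω → ℝ} {B : Set Ω} {K L : ℝ} (hf : Measurable f)
    (hB : MeasurableSet B) (h : ∀ ω ∈ B, |f ω| ≤ K) (hL : ∀ ω ∈ B, f ω ≤ L) :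
    ∫ ω in B, f ω ∂P ≤ L * P.real B := by
  have := setIntegral_mono_on (integrableOn_of_abs_le (P := P) hf hB h)
    (integrableOn_const (C := L) (measure_ne_top P B)) hB hL
  simpa [mul_comm] using this

namespace IsBoundedNoise

omit [IsProbabilityMeasure P] in
lemma measurable' (h : IsBoundedNoise P ℱ γ C c ζ) (n : ℕ) : Measurable (ζ n) :=
  (h.measurable n).mono (ℱ.le _) le_rfl

omit [IsProbabilityMeasure P] in
lemma neg (h : IsBoundedNoise P ℱ γ C c ζ) :
    IsBoundedNoise P ℱ γ C c (fun n ω => -ζ n ω) where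
  measurable n := (h.measurable n).neg
  bound n ω := by simpa using h.bound n ω
  condExp_eq_zero n := by
    filter_upwards [condExp_neg (μ := P) (ζ n) (ℱ n), h.condExp_eq_zero n] with ω h1 h2
    have : (fun ω => -ζ n ω) = -ζ n := rfl
    rw [this, h1]; simp [h2]
  le_condExp_sq n := by simpa using h.le_condExp_sq n

/-- Orthogonality of the noise to the past. The bound on `f` is needed only on `B`, because `f` is
first truncated by the indicator of `B`. -/
lemma setIntegral_mul_eq_zero (h : IsBoundedNoise P ℱ γ C c ζ) (n : ℕ) {f : Ω → ℝ} {B : Set Ω}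
    {K : ℝ} (hf : Measurable[ℱ n] f) (hB : MeasurableSet[ℱ n] B) (hK : ∀ ω ∈ B, |f ω| ≤ K) :
    ∫ ω in B, f ω * ζ n ω ∂P = 0 := by
  have hle := ℱ.le n
  have hF : Measurable[ℱ n] (B.indicator f) := hf.indicator hB
  have hbd : ∀ ω, |B.indicator f ω| ≤ max K 0 := by
    intro ω
    by_cases hω : ω ∈ B
    · simp [hω, hK ω hω]
    · simp [hω]
  have hζ : Integrable (ζ n) P := integrable_of_abs_le (h.measurable' n) (h.bound n)
  have hmul : Integrable (B.indicator f * ζ n) P := by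
    refine integrable_of_abs_le (K := max K 0 * (C * γ n))
      ((hF.mono hle le_rfl).mul (h.measurable' n)) fun ω => ?_
    rw [Pi.mul_apply, abs_mul]
    exact mul_le_mul (hbd ω) (h.bound n ω) (abs_nonneg _) (le_max_right _ _)
  have h1 := condExp_mul_of_stronglyMeasurable_left (μ := P) (m := ℱ n) hF.stronglyMeasurable
    hmul hζ
  have h2 : P[B.indicator f * ζ n | ℱ n] =ᵐ[P] 0 := by
    filter_upwards [h1, h.condExp_eq_zero n] with ω e1 e2
    rw [e1, Pi.mul_apply, e2]; simp
  rw [← integral_indicator (hle _ hB)]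
  have h3 : (B.indicator fun ω => f ω * ζ n ω) = B.indicator f * ζ n := by
    ext ω
    by_cases hω : ω ∈ B <;> simp [hω]
  rw [h3, ← integral_condExp hle, integral_congr_ae h2]
  simp

omit [IsProbabilityMeasure P] in
lemma sq_le (h : IsBoundedNoise P ℱ γ C c ζ) (n : ℕ) (ω : Ω) : ζ n ω ^ 2 ≤ C ^ 2 * γ n ^ 2 := by
  rw [← mul_pow]
  exact sq_le_sq' (abs_le.1 (h.bound n ω)).1 (abs_le.1 (h.bound n ω)).2

omit [IsProbabilityMeasure P] in
lemma abs_sq_le (h : IsBoundedNoise P ℱ γ C c ζ) (n : ℕ) (ω : Ω) :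
    |ζ n ω ^ 2| ≤ C ^ 2 * γ n ^ 2 := by
  rw [abs_of_nonneg (sq_nonneg _)]; exact h.sq_le n ω

lemma le_setIntegral_sq (h : IsBoundedNoise P ℱ γ C c ζ) (n : ℕ) {B : Set Ω}
    (hB : MeasurableSet[ℱ n] B) : c * γ n ^ 2 * P.real B ≤ ∫ ω in B, ζ n ω ^ 2 ∂P := by
  have hi : Integrable (fun ω => ζ n ω ^ 2) P :=
    integrable_of_abs_le ((h.measurable' n).pow_const 2) (h.abs_sq_le n)
  rw [← setIntegral_condExp (ℱ.le n) hi hB]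
  have := setIntegral_mono_ae (s := B) (μ := P) (integrableOn_const (measure_ne_top P B))
    integrable_condExp.integrableOn (h.le_condExp_sq n)
  simpa [mul_comm] using this

/-- Second moment of a stopped sum of noise terms, started at `-t`. -/
lemma setIntegral_sq_sum_le (h : IsBoundedNoise P ℱ γ C c ζ) (k : ℕ) (D : ℕ → Set Ω)
    (hD : ∀ i, MeasurableSet[ℱ (k + i)] (D i)) {H : Set Ω} (hH : MeasurableSet[ℱ k] H) (t : ℝ)
    (j : ℕ) :
    ∫ ω in H, (∑ i ∈ Finset.range j, (D i).indicator (ζ (k + i)) ω - t) ^ 2 ∂P ≤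
      (t ^ 2 + C ^ 2 * ∑ i ∈ Finset.range j, γ (k + i) ^ 2) * P.real H := by
  have hm : ∀ j, Measurable[ℱ (k + j)]
      (fun ω => ∑ i ∈ Finset.range j, (D i).indicator (ζ (k + i)) ω - t) := by
    intro j
    refine Measurable.sub_const (Finset.measurable_sum _ fun i hi => ?_) t
    have hij := Finset.mem_range.1 hi
    exact (((h.measurable (k + i)).indicator (ℱ.mono (Nat.le_succ _) _ (hD i)))).mono
      (ℱ.mono (by omega)) le_rfl
  have hb : ∀ j, ∃ K, ∀ ω, |∑ i ∈ Finset.range j, (D i).indicator (ζ (k + i)) ω - t| ≤ K := by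
    intro j
    refine ⟨∑ i ∈ Finset.range j, |C * γ (k + i)| + |t|, fun ω => ?_⟩
    refine (abs_sub _ _).trans (add_le_add_left ?_ _)
    refine (Finset.abs_sum_le_sum_abs _ _).trans (Finset.sum_le_sum fun i _ => ?_)
    by_cases hω : ω ∈ D i
    · simpa [hω] using (h.bound (k + i) ω).trans (le_abs_self _)
    · simp [hω, mul_nonneg]
  induction j with
  | zero => simp [mul_comm]
  | succ j ih =>
    obtain ⟨K, hK⟩ := hb j
    set X := fun ω => ∑ i ∈ Finset.range j, (D i).indicator (ζ (k + i)) ω - t with hX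
    have hmX : Measurable X := (hm j).mono (ℱ.le _) le_rfl
    have hHj : MeasurableSet[ℱ (k + j)] H := ℱ.mono (Nat.le_add_right _ _) _ hH
    have hH0 : MeasurableSet H := ℱ.le _ _ hH
    have hD0 : MeasurableSet (D j) := ℱ.le _ _ (hD j)
    have hζ0 := h.measurable' (k + j)
    have e : ∀ ω, (∑ i ∈ Finset.range (j + 1), (D i).indicator (ζ (k + i)) ω - t) ^ 2 =
        X ω ^ 2 + ((D j).indicator (fun ω => 2 * X ω * ζ (k + j) ω) ω +
          (D j).indicator (fun ω => ζ (k + j) ω ^ 2) ω) := by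
      intro ω
      rw [Finset.sum_range_succ]
      by_cases hω : ω ∈ D j <;> simp [hω, hX] <;> ring
    have hK0 : ∀ ω, 0 ≤ K := fun ω => (abs_nonneg _).trans (hK ω)
    have i1 : IntegrableOn (fun ω => X ω ^ 2) H P :=
      integrableOn_of_abs_le (K := K ^ 2) (hmX.pow_const 2) hH0 fun ω _ => by
        rw [abs_pow]; exact pow_le_pow_left₀ (abs_nonneg _) (hK ω) 2
    have i2 : IntegrableOn ((D j).indicator (fun ω => 2 * X ω * ζ (k + j) ω)) H P := by
      refine integrableOn_of_abs_le (K := 2 * K * (C * γ (k + j)))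
        (((hmX.const_mul 2).mul hζ0).indicator hD0) hH0 fun ω _ => ?_
      have hb2 : |2 * X ω * ζ (k + j) ω| ≤ 2 * K * (C * γ (k + j)) := by
        rw [abs_mul, abs_mul, abs_two]
        have := hK0 ω
        exact mul_le_mul (by linarith [hK ω]) (h.bound _ _) (abs_nonneg _) (by positivity)
      by_cases hω : ω ∈ D j
      · simpa [hω] using hb2
      · simpa [hω] using (abs_nonneg _).trans hb2
    have i3 : IntegrableOn ((D j).indicator (fun ω => ζ (k + j) ω ^ 2)) H P := by
      refine integrableOn_of_abs_le (K := C ^ 2 * γ (k + j) ^ 2)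
        ((hζ0.pow_const 2).indicator hD0) hH0 fun ω _ => ?_
      by_cases hω : ω ∈ D j
      · simpa [hω] using h.sq_le (k + j) ω
      · simpa [hω] using by positivity
    simp_rw [e]
    have i23 := integral_add i1 (i2.add i3)
    simp only [Pi.add_apply] at i23
    rw [i23, integral_add i2 i3]
    -- The partial sum, `H` and `D j` are all known at time `k + j`, so the cross term vanishes.
    have z : ∫ ω in H, (D j).indicator (fun ω => 2 * X ω * ζ (k + j) ω) ω ∂P = 0 := by
      rw [setIntegral_indicator hD0]
      refine h.setIntegral_mul_eq_zero (k + j) (f := fun ω => 2 * X ω) (K := 2 * K)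
        ((hm j).const_mul 2) (hHj.inter (hD j)) fun ω _ => ?_
      rw [abs_mul, abs_two]; linarith [hK ω]
    have q : ∫ ω in H, (D j).indicator (fun ω => ζ (k + j) ω ^ 2) ω ∂P ≤
        C ^ 2 * γ (k + j) ^ 2 * P.real H := by
      refine setIntegral_le_of_abs_le (K := C ^ 2 * γ (k + j) ^ 2)
        ((hζ0.pow_const 2).indicator hD0) hH0 (fun ω _ => ?_) fun ω _ => ?_
      all_goals
        by_cases hω : ω ∈ D j
        · simpa [hω] using h.sq_le (k + j) ω
        · simpa [hω] using by positivity
    rw [z, Finset.sum_range_succ]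
    nlinarith [ih, q]

end IsBoundedNoise

end Noise

/-- A stochastic recursion with drift `d` pointing away from `0` on `(-δ, δ)` and noise at
scale `γ`. -/
structure IsRepelled {Ω : Type*} {m0 : MeasurableSpace Ω} (P : Measure Ω)
    (ℱ : Filtration ℕ m0) (γ : ℕ → ℝ) (C c δ : ℝ) (y d : ℕ → Ω → ℝ) : Prop where
  noise : IsBoundedNoise P ℱ γ C c (fun n ω => y (n + 1) ω - y n ω - d n ω)
  measurable : ∀ n, Measurable[ℱ n] (y n)
  measurable_drift : ∀ n, Measurable[ℱ n] (d n)
  drift_bound : ∀ n ω, |d n ω| ≤ C * γ n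
  repel : ∀ n ω, |y n ω| < δ → 0 ≤ y n ω * d n ω

/-! ### Escape from a repelling point: paths already at a distance -/

namespace IsRepelled

variable {Ω : Type*} {m0 : MeasurableSpace Ω} {P : Measure Ω} [IsProbabilityMeasure P]
  {ℱ : Filtration ℕ m0} {γ : ℕ → ℝ} {C c δ : ℝ} {y d : ℕ → Ω → ℝ}

omit [IsProbabilityMeasure P] in
lemma neg (h : IsRepelled P ℱ γ C c δ y d) :
    IsRepelled P ℱ γ C c δ (fun n ω => -y n ω) (fun n ω => -d n ω) where
  noise := by
    have := h.noise.neg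
    convert this using 3
    ring
  measurable n := (h.measurable n).neg
  measurable_drift n := (h.measurable_drift n).neg
  drift_bound n ω := by simpa using h.drift_bound n ω
  repel n ω hn := by simpa using h.repel n ω (by simpa using hn)

omit [IsProbabilityMeasure P] in
lemma measurable' (h : IsRepelled P ℱ γ C c δ y d) (n : ℕ) : Measurable (y n) :=
  (h.measurable n).mono (ℱ.le _) le_rfl

/-- A path above `a > 0` that converges to `0` inside `(-δ, δ)` must be brought down by noise. -/
lemma measureReal_inter_le_of_le (h : IsRepelled P ℱ γ C c δ y d) {k : ℕ} {a v : ℝ} (ha : 0 < a)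
    (hv : 0 < v) (hsum : ∀ j, C ^ 2 * ∑ i ∈ Finset.range j, γ (k + i) ^ 2 ≤ v) {H : Set Ω}
    (hH : MeasurableSet[ℱ k] H) (hHa : ∀ ω ∈ H, 2 * a ≤ y k ω) :
    P.real ({ω | Tendsto (fun n => y n ω) atTop (𝓝 0) ∧ ∀ j, k ≤ j → |y j ω| < δ} ∩ H) ≤
      v / (v + a ^ 2) * P.real H := by
  set ζ : ℕ → Ω → ℝ := fun n ω => y (n + 1) ω - y n ω - d n ω with hζ
  -- The path has not yet left `(0, δ)` by time `k + i`. The sum `X` below is the noise stopped at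
  -- the first exit.
  set D : ℕ → Set Ω := fun i => {ω | ∀ i' ≤ i, 0 < y (k + i') ω ∧ y (k + i') ω < δ} with hDdef
  have hD : ∀ i, MeasurableSet[ℱ (k + i)] (D i) := by
    intro i
    have : D i = ⋂ i' ≤ i, (y (k + i')) ⁻¹' Set.Ioo 0 δ := by
      ext ω; simp [hDdef]
    rw [this]
    refine MeasurableSet.iInter fun i' => MeasurableSet.iInter fun hi' => ?_
    exact ℱ.mono (by omega) _ (h.measurable (k + i') measurableSet_Ioo)
  set X : ℕ → Ω → ℝ := fun j ω => ∑ i ∈ Finset.range j, (D i).indicator (ζ (k + i)) ω with hXdef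
  have hXm : ∀ j, Measurable (X j) := fun j =>
    Finset.measurable_sum _ fun i _ => (h.noise.measurable' (k + i)).indicator (ℱ.le _ _ (hD i))
  have hH0 := ℱ.le _ _ hH
  set E : ℕ → Set Ω := fun j => H ∩ {ω | X j ω ≤ -a} with hEdef
  have hEm : ∀ j, MeasurableSet (E j) := fun j => hH0.inter (hXm j measurableSet_Iic)
  -- Cantelli's inequality
  have hE : ∀ j, P.real (E j) ≤ v / (v + a ^ 2) * P.real H := by
    intro j
    -- The shift `v / a` is the one for which Chebyshev's bound becomes `v / (v + a ^ 2)`, strictly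
    -- below `1`.
    have h1 := h.noise.setIntegral_sq_sum_le k D hD hH (v / a) j
    have hint : IntegrableOn (fun ω => (X j ω - v / a) ^ 2) H P := by
      obtain ⟨K, hK⟩ : ∃ K, ∀ ω, |X j ω - v / a| ≤ K := by
        refine ⟨∑ i ∈ Finset.range j, |C * γ (k + i)| + |v / a|, fun ω => ?_⟩
        refine (abs_sub _ _).trans (add_le_add_left ?_ _)
        refine (Finset.abs_sum_le_sum_abs _ _).trans (Finset.sum_le_sum fun i _ => ?_)
        by_cases hω : ω ∈ D i
        · simpa [hω] using (h.noise.bound (k + i) ω).trans (le_abs_self _)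
        · simp [hω, mul_nonneg]
      exact integrableOn_of_abs_le (K := K ^ 2) (((hXm j).sub_const _).pow_const 2) hH0
        fun ω _ => by rw [abs_pow]; exact pow_le_pow_left₀ (abs_nonneg _) (hK ω) 2
    have h2 : (a + v / a) ^ 2 * P.real (E j) ≤ ∫ ω in H, (X j ω - v / a) ^ 2 ∂P := by
      calc (a + v / a) ^ 2 * P.real (E j) = ∫ ω in E j, (a + v / a) ^ 2 ∂P := by
            simp [mul_comm]
        _ ≤ ∫ ω in E j, (X j ω - v / a) ^ 2 ∂P := by
            refine setIntegral_mono_on (integrableOn_const (measure_ne_top P _))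
              (hint.mono_set Set.inter_subset_left) (hEm j) fun ω hω => ?_
            have : X j ω ≤ -a := hω.2
            have : 0 < v / a := by positivity
            nlinarith
        _ ≤ _ := setIntegral_mono_set hint (ae_of_all _ fun ω => sq_nonneg _)
            (ae_of_all _ fun ω hω => hω.1)
    have h3 : (a + v / a) ^ 2 * P.real (E j) ≤ ((v / a) ^ 2 + v) * P.real H :=
      (h2.trans h1).trans (mul_le_mul_of_nonneg_right (by linarith [hsum j]) measureReal_nonneg)
    have h4 : (v / a) ^ 2 + v = (a + v / a) ^ 2 * (v / (v + a ^ 2)) := by field_simp; ring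
    rw [h4, mul_assoc] at h3
    exact le_of_mul_le_mul_left h3 (by positivity)
  -- pathwise inclusion
  have hsub : {ω | Tendsto (fun n => y n ω) atTop (𝓝 0) ∧ ∀ j, k ≤ j → |y j ω| < δ} ∩ H ⊆
      ⋃ N, ⋂ j ≥ N, E j := by
    rintro ω ⟨⟨hlim, hδ⟩, hωH⟩
    have hya := hHa ω hωH
    -- Inside `(0, δ)` the drift is nonnegative, so the path dominates its starting value plus the
    -- noise.
    have key : ∀ j, ω ∈ D j → y k ω + X (j + 1) ω ≤ y (k + j + 1) ω := by
      intro j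
      induction j with
      | zero =>
        intro hj
        have h0 := (hj 0 le_rfl).1
        have := h.repel (k + 0) ω (hδ _ le_self_add)
        have hd := nonneg_of_mul_nonneg_right this h0
        simp only [hXdef, zero_add, Finset.sum_range_one, Set.indicator_of_mem hj, hζ]
        simp only [add_zero] at hd ⊢
        linarith
      | succ j ih =>
        intro hj
        have hj' : ω ∈ D j := fun i hi => hj i (by omega)
        have h0 := (hj (j + 1) le_rfl).1
        have := h.repel (k + (j + 1)) ω (hδ _ (by omega))
        have hd := nonneg_of_mul_nonneg_right this h0
        have := ih hj'
        have e : X (j + 1 + 1) ω = X (j + 1) ω + ζ (k + (j + 1)) ω := by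
          simp only [hXdef, Finset.sum_range_succ _ (j + 1), Set.indicator_of_mem hj]
        rw [e]
        simp only [hζ]
        simp only [← add_assoc] at hd this ⊢
        linarith
    -- If the path stays positive, convergence to `0` brings it below `a` from at least `2a`.
    -- Otherwise it leaves through `0`, where `X ≤ -2a`, and `X` is frozen from then on.
    have hfin : ∃ N, ∀ j ≥ N, X j ω ≤ -a := by
      by_cases hall : ∀ j, ω ∈ D j
      · obtain ⟨N, hN⟩ := eventually_atTop.1 (hlim.eventually (gt_mem_nhds ha))
        refine ⟨N + 1, fun j hj => ?_⟩
        obtain ⟨i, rfl⟩ : ∃ i, j = i + 1 := ⟨j - 1, by omega⟩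
        have := key i (hall i)
        have := hN (k + i + 1) (by omega)
        linarith
      · push Not at hall
        classical
        have hspec := Nat.find_spec hall
        have hmin := fun i (hi : i < Nat.find hall) => not_not.1 (Nat.find_min hall hi)
        set M := Nat.find hall
        have hM0 : M ≠ 0 := by
          intro h0
          apply hspec
          intro i hi
          obtain rfl : i = 0 := by omega
          rw [add_zero]
          exact ⟨by linarith, (abs_lt.1 (hδ k le_rfl)).2⟩
        obtain ⟨M', hM'⟩ : ∃ M', M = M' + 1 := ⟨M - 1, by omega⟩
        have hy : y (k + M' + 1) ω ≤ 0 := by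
          by_contra hpos
          apply hspec
          intro i hi
          rcases Nat.lt_or_ge i M with hlt | hge
          · exact hmin i hlt i le_rfl
          · obtain rfl : i = M' + 1 := by omega
            exact ⟨by simpa [add_assoc] using hpos, (abs_lt.1 (hδ _ (by omega))).2⟩
        have hX := key M' (hmin M' (by omega))
        refine ⟨M' + 1, fun j hj => ?_⟩
        have : X j ω = X (M' + 1) ω := by
          induction j, hj using Nat.le_induction with
          | base => rfl
          | succ j hj ih =>
            have hn : ω ∉ D j := fun hmem => hspec fun i hi => hmem i (by omega)
            rw [← ih]
            simp only [hXdef, Finset.sum_range_succ, Set.indicator_of_notMem hn, add_zero]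
        linarith
    obtain ⟨N, hN⟩ := hfin
    exact Set.mem_iUnion.2 ⟨N, Set.mem_iInter₂.2 fun j hj => ⟨hωH, hN j hj⟩⟩
  have hmono : Monotone fun N => ⋂ j ≥ N, E j := by
    intro N N' hNN ω hω
    simp only [Set.mem_iInter] at hω ⊢
    exact fun j hj => hω j (hNN.trans hj)
  have hlim := tendsto_measure_iUnion_atTop (μ := P) hmono
  have hle : P (⋃ N, ⋂ j ≥ N, E j) ≤ ENNReal.ofReal (v / (v + a ^ 2) * P.real H) := by
    refine le_of_tendsto' hlim fun N => ?_
    refine (measure_mono (Set.biInter_subset_of_mem (le_refl N) :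
      (⋂ j ≥ N, E j) ⊆ E N)).trans ?_
    rw [← ENNReal.ofReal_toReal (measure_ne_top P (E N))]
    exact ENNReal.ofReal_le_ofReal (hE N)
  exact ENNReal.toReal_le_of_le_ofReal (by positivity) ((measure_mono hsub).trans hle)

/-- The sign of `y k` is known at time `k`, so the one-sided bound applies separately to `y` and
`-y`. -/
lemma measureReal_inter_le_of_le_abs (h : IsRepelled P ℱ γ C c δ y d) {k : ℕ} {a v : ℝ}
    (ha : 0 < a) (hv : 0 < v) (hsum : ∀ j, C ^ 2 * ∑ i ∈ Finset.range j, γ (k + i) ^ 2 ≤ v)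
    {H : Set Ω} (hH : MeasurableSet[ℱ k] H) (hHa : ∀ ω ∈ H, 2 * a ≤ |y k ω|) :
    P.real ({ω | Tendsto (fun n => y n ω) atTop (𝓝 0) ∧ ∀ j, k ≤ j → |y j ω| < δ} ∩ H) ≤
      v / (v + a ^ 2) * P.real H := by
  set A := {ω | Tendsto (fun n => y n ω) atTop (𝓝 0) ∧ ∀ j, k ≤ j → |y j ω| < δ} with hA
  have hpos : MeasurableSet[ℱ k] {ω | 0 ≤ y k ω} := h.measurable k measurableSet_Ici
  have h1 := h.measureReal_inter_le_of_le ha hv hsum (hH.inter hpos) fun ω hω => by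
    have := hHa ω hω.1
    rwa [abs_of_nonneg hω.2] at this
  have h2 := h.neg.measureReal_inter_le_of_le ha hv hsum (hH.diff hpos) fun ω hω => by
    have := hHa ω hω.1
    rwa [abs_of_neg (not_le.1 hω.2)] at this
  have hAn : {ω | Tendsto (fun n => -y n ω) atTop (𝓝 0) ∧ ∀ j, k ≤ j → |-y j ω| < δ} = A := by
    ext ω
    have : Tendsto (fun n => -y n ω) atTop (𝓝 0) ↔ Tendsto (fun n => y n ω) atTop (𝓝 0) := by
      rw [← tendsto_neg_iff]; simp
    simp [hA, this]
  rw [hAn] at h2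
  have e : P.real H = P.real (H ∩ {ω | 0 ≤ y k ω}) + P.real (H \ {ω | 0 ≤ y k ω}) :=
    (measureReal_inter_add_sdiff (ℱ.le _ _ hpos)).symm
  have hs : A ∩ H ⊆ A ∩ (H ∩ {ω | 0 ≤ y k ω}) ∪ A ∩ (H \ {ω | 0 ≤ y k ω}) := by
    rintro ω ⟨hω, hω'⟩
    by_cases hy : 0 ≤ y k ω
    · exact Or.inl ⟨hω, hω', hy⟩
    · exact Or.inr ⟨hω, hω', hy⟩
  have h3 := (measureReal_mono hs (measure_ne_top P _)).trans (measureReal_union_le _ _)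
  rw [e, mul_add]
  linarith

end IsRepelled

/-! ### Escape from a repelling point: leaving a small window, and the 0-1 law -/

namespace IsRepelled

variable {Ω : Type*} {m0 : MeasurableSpace Ω} {P : Measure Ω} [IsProbabilityMeasure P]
  {ℱ : Filtration ℕ m0} {γ : ℕ → ℝ} {C c δ : ℝ} {y d : ℕ → Ω → ℝ}

/-- Second-moment lower bound for the process until it leaves `(-R, R)`. -/
lemma le_sq_mul_measureReal (h : IsRepelled P ℱ γ C c δ y d) (hc : 0 ≤ c) {R R' : ℝ}
    (hRδ : R ≤ δ) (n : ℕ) (hR' : ∀ i, R + 2 * (C * γ (n + i)) ≤ R') {B : ℕ → Set Ω}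
    (hB : ∀ i, MeasurableSet[ℱ (n + i)] (B i)) (hanti : ∀ i, B (i + 1) ⊆ B i)
    (hy : ∀ i, ∀ ω ∈ B i, |y (n + i) ω| < R) (j : ℕ) :
    c * (∑ i ∈ Finset.range j, γ (n + i) ^ 2) * P.real (B j) ≤
      R ^ 2 * P.real (B j) + R' ^ 2 * (P.real (B 0) - P.real (B j)) := by
  set ζ : ℕ → Ω → ℝ := fun n ω => y (n + 1) ω - y n ω - d n ω with hζ
  have hB0 : ∀ i, MeasurableSet (B i) := fun i => ℱ.le _ _ (hB i)
  have hdm : ∀ i, Measurable (d i) := fun i => (h.measurable_drift i).mono (ℱ.le _) le_rfl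
  have hsqR : ∀ i, ∀ ω ∈ B i, y (n + i) ω ^ 2 ≤ R ^ 2 := fun i ω hω =>
    sq_le_sq' (by linarith [(abs_lt.1 (hy i ω hω)).1]) (abs_lt.1 (hy i ω hω)).2.le
  have hnext : ∀ i, ∀ ω ∈ B i, y (n + i + 1) ω ^ 2 ≤ R' ^ 2 := by
    intro i ω hω
    have e : y (n + i + 1) ω = y (n + i) ω + d (n + i) ω + ζ (n + i) ω := by simp [hζ]
    have h1 := abs_lt.1 (hy i ω hω)
    have h2 := abs_le.1 (h.drift_bound (n + i) ω)
    have h3 := abs_le.1 (h.noise.bound (n + i) ω)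
    have h4 := hR' i
    rw [e]
    exact sq_le_sq' (by simp only [hζ]; linarith) (by simp only [hζ]; linarith)
  have step : ∀ i, ∫ ω in B i, y (n + i) ω ^ 2 ∂P + c * γ (n + i) ^ 2 * P.real (B i) ≤
      ∫ ω in B (i + 1), y (n + (i + 1)) ω ^ 2 ∂P +
        R' ^ 2 * (P.real (B i) - P.real (B (i + 1))) := by
    intro i
    have hyd : ∀ ω ∈ B i, |y (n + i) ω + d (n + i) ω| ≤ R + C * γ (n + i) := fun ω hω =>
      (abs_add_le _ _).trans (add_le_add (hy i ω hω).le (h.drift_bound _ _))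
    have my := h.measurable' (n + i)
    have md := hdm (n + i)
    have mζ := h.noise.measurable' (n + i)
    have i1 : IntegrableOn (fun ω => y (n + i) ω ^ 2) (B i) P :=
      integrableOn_of_abs_le (K := R ^ 2) (my.pow_const 2) (hB0 i) fun ω hω => by
        rw [abs_of_nonneg (sq_nonneg _)]; exact hsqR i ω hω
    have i2 : IntegrableOn (fun ω => 2 * (y (n + i) ω + d (n + i) ω) * ζ (n + i) ω) (B i) P := by
      refine integrableOn_of_abs_le (K := 2 * (R + C * γ (n + i)) * (C * γ (n + i)))
        (((my.add md).const_mul 2).mul mζ) (hB0 i) fun ω hω => ?_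
      rw [abs_mul, abs_mul, abs_two]
      have := (abs_nonneg _).trans (hyd ω hω)
      exact mul_le_mul (by linarith [hyd ω hω]) (h.noise.bound _ _) (abs_nonneg _) (by positivity)
    have i3 : IntegrableOn (fun ω => ζ (n + i) ω ^ 2) (B i) P :=
      integrableOn_of_abs_le (mζ.pow_const 2) (hB0 i) fun ω _ => h.noise.abs_sq_le (n + i) ω
    have i4 : IntegrableOn (fun ω => y (n + i + 1) ω ^ 2) (B i) P :=
      integrableOn_of_abs_le (K := R' ^ 2) ((h.measurable' _).pow_const 2) (hB0 i) fun ω hω => by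
        rw [abs_of_nonneg (sq_nonneg _)]; exact hnext i ω hω
    have low : ∫ ω in B i, y (n + i) ω ^ 2 ∂P + c * γ (n + i) ^ 2 * P.real (B i) ≤
        ∫ ω in B i, y (n + i + 1) ω ^ 2 ∂P := by
      calc _ ≤ ∫ ω in B i, y (n + i) ω ^ 2 ∂P + ∫ ω in B i, ζ (n + i) ω ^ 2 ∂P :=
            add_le_add_right (h.noise.le_setIntegral_sq _ (hB i)) _
        _ = ∫ ω in B i, ((y (n + i) ω ^ 2 +
              2 * (y (n + i) ω + d (n + i) ω) * ζ (n + i) ω) + ζ (n + i) ω ^ 2) ∂P := by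
            have i123 := integral_add (i1.add i2) i3
            simp only [Pi.add_apply] at i123
            rw [i123, integral_add i1 i2,
              h.noise.setIntegral_mul_eq_zero (n + i)
                (f := fun ω => 2 * (y (n + i) ω + d (n + i) ω)) (K := 2 * (R + C * γ (n + i)))
                (((h.measurable _).add (h.measurable_drift _)).const_mul 2) (hB i)
                fun ω hω => by rw [abs_mul, abs_two]; linarith [hyd ω hω], add_zero]
        _ ≤ _ := by
            refine setIntegral_mono_on ((i1.add i2).add i3) i4 (hB0 i) fun ω hω => ?_
            have e : y (n + i + 1) ω = y (n + i) ω + d (n + i) ω + ζ (n + i) ω := by simp [hζ]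
            have := h.repel (n + i) ω ((hy i ω hω).trans_le hRδ)
            rw [e]
            -- Repulsion makes the cross term `2 y d` nonnegative, so the drift only increases the
            -- second moment.
            nlinarith [sq_nonneg (d (n + i) ω)]
    refine low.trans ?_
    -- Paths leaving at this step overshoot to at most `R'`, so dropping them costs at most `R' ^ 2`
    -- times their probability.
    have hsplit := integral_inter_add_sdiff (hB0 (i + 1)) i4
    rw [Set.inter_eq_right.2 (hanti i)] at hsplit
    rw [← hsplit, add_assoc n i 1]
    refine add_le_add_right ?_ _
    rw [← measureReal_sdiff (hanti i) (hB0 (i + 1))]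
    refine setIntegral_le_of_abs_le (K := R' ^ 2) ((h.measurable' _).pow_const 2)
      ((hB0 i).diff (hB0 (i + 1))) (fun ω hω => ?_) fun ω hω => hnext i ω hω.1
    rw [abs_of_nonneg (sq_nonneg _)]; exact hnext i ω hω.1
  have main : c * (∑ i ∈ Finset.range j, γ (n + i) ^ 2) * P.real (B j) ≤
      ∫ ω in B j, y (n + j) ω ^ 2 ∂P + R' ^ 2 * (P.real (B 0) - P.real (B j)) := by
    induction j with
    | zero =>
      simpa using setIntegral_nonneg (hB0 0) fun ω _ => sq_nonneg _
    | succ j ih =>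
      have hle : P.real (B (j + 1)) ≤ P.real (B j) := measureReal_mono (hanti j)
      have hs : 0 ≤ c * (∑ i ∈ Finset.range (j + 1), γ (n + i) ^ 2) := by positivity
      have := mul_le_mul_of_nonneg_left hle hs
      have h2 := step j
      rw [Finset.sum_range_succ] at this ⊢
      nlinarith
  refine main.trans (add_le_add_left ?_ _)
  refine setIntegral_le_of_abs_le (K := R ^ 2) ((h.measurable' _).pow_const 2) (hB0 j)
    (fun ω hω => ?_) (hsqR j)
  rw [abs_of_nonneg (sq_nonneg _)]; exact hsqR j ω hω

/-- With `T n` the tail of `∑ γ ^ 2`, the window of radius `K * √(T n)` makes both estimates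
scale-invariant. Outside, return has conditional probability at most `κ`; inside, exit has
probability at least `p`. The resulting `q = 1 - (1 - κ) * p` is independent of `n` and `G`. -/
lemma measureReal_inter_le (h : IsRepelled P ℱ γ C c δ y d) (hc : 0 < c) (hC : 0 < C)
    (hγ : ∀ n, 0 < γ n) (hsum : Summable fun n => γ n ^ 2) (hδ : 0 < δ) (m : ℕ) :
    ∃ q < 1, ∀ᶠ n in atTop, ∀ G, MeasurableSet[ℱ n] G →
      P.real ({ω | Tendsto (fun n => y n ω) atTop (𝓝 0) ∧ ∀ j, m ≤ j → |y j ω| < δ} ∩ G) ≤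
        q * P.real G := by
  set A := {ω | Tendsto (fun n => y n ω) atTop (𝓝 0) ∧ ∀ j, m ≤ j → |y j ω| < δ} with hA
  set T : ℕ → ℝ := fun n => ∑' i, γ (n + i) ^ 2 with hT
  have hs : ∀ n, Summable fun i => γ (n + i) ^ 2 := fun n => by
    simpa [add_comm] using (summable_nat_add_iff n).2 hsum
  have hTpos : ∀ n, 0 < T n := fun n =>
    (hs n).tsum_pos (fun i => sq_nonneg _) 0 (pow_pos (hγ _) 2)
  have hTlim : Tendsto T atTop (𝓝 0) := by
    have := tendsto_sum_nat_add fun n => γ n ^ 2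
    simpa [hT, add_comm] using this
  have hpart : ∀ n j, ∑ i ∈ Finset.range j, γ (n + i) ^ 2 ≤ T n := fun n j =>
    (hs n).sum_le_tsum _ fun i _ => sq_nonneg _
  have hγT : ∀ n i, γ (n + i) ≤ Real.sqrt (T n) := fun n i =>
    Real.le_sqrt_of_sq_le ((hs n).le_tsum i fun _ _ => sq_nonneg _)
  have hTanti : ∀ n i, T (n + i) ≤ T n := fun n i => by
    have := (hs n).sum_add_tsum_nat_add i
    have h0 : 0 ≤ ∑ j ∈ Finset.range i, γ (n + j) ^ 2 := Finset.sum_nonneg fun _ _ => sq_nonneg _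
    have e : T (n + i) = ∑' j, γ (n + (j + i)) ^ 2 := by
      simp only [hT]; congr 1; ext j; congr 2; omega
    rw [e]; simp only [hT]; linarith
  -- Then `R ^ 2 = c T / 4`, well below the variance `c T` that the remaining noise injects.
  set K := Real.sqrt c / 2 with hK
  have hKpos : 0 < K := by positivity
  have hK2 : K ^ 2 = c / 4 := by rw [hK, div_pow, Real.sq_sqrt hc.le]; norm_num
  set κ := C ^ 2 / (C ^ 2 + (K / 2) ^ 2) with hκ
  have hκ1 : κ < 1 := by rw [hκ, div_lt_one (by positivity)]; linarith [pow_pos (half_pos hKpos) 2]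
  have hκ0 : 0 < κ := by positivity
  -- outside the window of radius `K √T`
  have out : ∀ k, m ≤ k → ∀ H, MeasurableSet[ℱ k] H → (∀ ω ∈ H, K * Real.sqrt (T k) ≤ |y k ω|) →
      P.real (A ∩ H) ≤ κ * P.real H := by
    intro k hk H hH hHy
    have hT0 := hTpos k
    have := h.measureReal_inter_le_of_le_abs (k := k) (a := K * Real.sqrt (T k) / 2)
      (v := C ^ 2 * T k) (by positivity) (by positivity)
      (fun j => mul_le_mul_of_nonneg_left (hpart k j) (by positivity)) hH
      (fun ω hω => by linarith [hHy ω hω])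
    have e : C ^ 2 * T k / (C ^ 2 * T k + (K * Real.sqrt (T k) / 2) ^ 2) = κ := by
      rw [hκ, div_pow, mul_pow, Real.sq_sqrt hT0.le]
      field_simp
    rw [e] at this
    refine le_trans (measureReal_mono ?_) this
    exact Set.inter_subset_inter_left _ fun ω hω => ⟨hω.1, fun j hj => hω.2 j (hk.trans hj)⟩
  -- Retained paths gain at least `3cT/4` but hold at most `cT/4`. The surplus `cT/2` must be
  -- carried by exiting paths, each holding at most `(K + 2C)² T`.
  set p := c / 2 / ((K + 2 * C) ^ 2 + c / 2) with hp
  have hp0 : 0 < p := by positivity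
  have hp1 : p < 1 := by
    rw [hp, div_lt_one (by positivity)]; linarith [pow_pos (by positivity : 0 < K + 2 * C) 2]
  refine ⟨1 - (1 - κ) * p, by nlinarith, ?_⟩
  have hsm : ∀ᶠ n in atTop, K * Real.sqrt (T n) < δ := by
    have : Tendsto (fun n => K * Real.sqrt (T n)) atTop (𝓝 0) := by
      simpa using (hTlim.sqrt).const_mul K
    exact this.eventually (gt_mem_nhds hδ)
  filter_upwards [hsm, eventually_ge_atTop m] with n hn hmn G hG
  set R := K * Real.sqrt (T n) with hR
  have hT0 := hTpos n
  have hRpos : 0 < R := by positivity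
  set B : ℕ → Set Ω := fun i => G ∩ {ω | ∀ i' ≤ i, |y (n + i') ω| < R} with hBdef
  have hBm : ∀ i, MeasurableSet[ℱ (n + i)] (B i) := by
    intro i
    have : {ω | ∀ i' ≤ i, |y (n + i') ω| < R} = ⋂ i' ≤ i, (y (n + i')) ⁻¹' Set.Ioo (-R) R := by
      ext ω; simp [abs_lt]
    simp only [hBdef]
    rw [this]
    refine (ℱ.mono (by omega) _ hG).inter (MeasurableSet.iInter fun i' =>
      MeasurableSet.iInter fun hi' => ?_)
    exact ℱ.mono (by omega) _ (h.measurable (n + i') measurableSet_Ioo)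
  have hB0 : ∀ i, MeasurableSet (B i) := fun i => ℱ.le _ _ (hBm i)
  have hanti : ∀ i, B (i + 1) ⊆ B i := fun i ω hω => ⟨hω.1, fun i' hi => hω.2 i' (by omega)⟩
  obtain ⟨j, hj⟩ : ∃ j, 3 / 4 * T n ≤ ∑ i ∈ Finset.range j, γ (n + i) ^ 2 := by
    have := (hs n).hasSum.tendsto_sum_nat.eventually
      (lt_mem_nhds (show 3 / 4 * T n < T n by linarith))
    obtain ⟨j, hj⟩ := this.exists
    exact ⟨j, hj.le⟩
  have hsec := h.le_sq_mul_measureReal hc.le hn.le n (R' := (K + 2 * C) * Real.sqrt (T n))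
    (fun i => by rw [hR]; nlinarith [mul_le_mul_of_nonneg_left (hγT n i) hC.le]) hBm hanti
    (fun i ω hω => hω.2 i le_rfl) j
  -- telescoping over the exit time
  have tel : ∀ i, P.real (A ∩ B 0) ≤ κ * (P.real (B 0) - P.real (B i)) + P.real (A ∩ B i) := by
    intro i
    induction i with
    | zero => simp
    | succ i ih =>
      have h1 := out (n + (i + 1)) (by omega) (B i \ B (i + 1))
        ((ℱ.mono (by omega) _ (hBm i)).diff (hBm (i + 1))) fun ω hω => by
          have : R ≤ |y (n + (i + 1)) ω| := by
            by_contra hlt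
            refine hω.2 ⟨hω.1.1, fun i' hi' => ?_⟩
            rcases Nat.lt_or_ge i i' with hlt' | hge
            · obtain rfl : i' = i + 1 := by omega
              exact not_le.1 hlt
            · exact hω.1.2 i' hge
          refine le_trans ?_ this
          rw [hR]
          -- Windows shrink in time, so leaving the window of time `n` also puts the path outside
          -- that of the exit time.
          exact mul_le_mul_of_nonneg_left (Real.sqrt_le_sqrt (hTanti n _)) hKpos.le
      rw [measureReal_sdiff (hanti i) (hB0 (i + 1))] at h1
      have h2 : A ∩ B i ⊆ A ∩ (B i \ B (i + 1)) ∪ A ∩ B (i + 1) := by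
        rintro ω ⟨hω, hω'⟩
        by_cases hb : ω ∈ B (i + 1)
        · exact Or.inr ⟨hω, hb⟩
        · exact Or.inl ⟨hω, hω', hb⟩
      have h3 := (measureReal_mono (μ := P) h2).trans (measureReal_union_le _ _)
      linarith
  have hAB : P.real (A ∩ B j) ≤ P.real (B j) := measureReal_mono Set.inter_subset_right
  have hu0 : 0 ≤ P.real (B j) := measureReal_nonneg
  have hexit : p * P.real (B 0) ≤ P.real (B 0) - P.real (B j) := by
    rw [hR, mul_pow, mul_pow, Real.sq_sqrt hT0.le, hK2] at hsec
    have h1 : c * (3 / 4 * T n) * P.real (B j) ≤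
        c / 4 * T n * P.real (B j) +
          (K + 2 * C) ^ 2 * T n * (P.real (B 0) - P.real (B j)) := by
      refine le_trans ?_ hsec
      gcongr
    have h2 : c / 2 * P.real (B j) ≤ (K + 2 * C) ^ 2 * (P.real (B 0) - P.real (B j)) := by
      refine le_of_mul_le_mul_left ?_ hT0
      nlinarith
    rw [hp, div_mul_eq_mul_div, div_le_iff₀ (by positivity)]
    nlinarith
  have hin : P.real (A ∩ B 0) ≤ (1 - (1 - κ) * p) * P.real (B 0) := by
    have := tel j
    nlinarith
  have hout := out n hmn (G \ B 0) (hG.diff (by simpa using hBm 0)) fun ω hω => by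
    by_contra hlt
    refine hω.2 ⟨hω.1, fun i' hi' => ?_⟩
    obtain rfl : i' = 0 := by omega
    exact not_le.1 hlt
  have hsubB : B 0 ⊆ G := Set.inter_subset_left
  have h2 : A ∩ G ⊆ A ∩ (G \ B 0) ∪ A ∩ B 0 := by
    rintro ω ⟨hω, hω'⟩
    by_cases hb : ω ∈ B 0
    · exact Or.inr ⟨hω, hb⟩
    · exact Or.inl ⟨hω, hω', hb⟩
  have h3 := (measureReal_mono (μ := P) h2).trans (measureReal_union_le _ _)
  have h4 := measureReal_sdiff (μ := P) hsubB (hB0 0)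
  have h5 : 0 ≤ P.real (G \ B 0) := measureReal_nonneg
  have h6 : κ * P.real (G \ B 0) ≤ (1 - (1 - κ) * p) * P.real (G \ B 0) :=
    mul_le_mul_of_nonneg_right (by nlinarith) h5
  have h7 : (1 - (1 - κ) * p) * P.real G =
      (1 - (1 - κ) * p) * P.real (G \ B 0) + (1 - (1 - κ) * p) * P.real (B 0) := by
    rw [h4]; ring
  linarith

/-- A repelled process with nondegenerate noise almost surely does not converge to the
repelling point. -/
theorem ae_not_tendsto_zero (h : IsRepelled P ℱ γ C c δ y d) (hc : 0 < c) (hC : 0 < C)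
    (hγ : ∀ n, 0 < γ n) (hsum : Summable fun n => γ n ^ 2) (hδ : 0 < δ) :
    ∀ᵐ ω ∂P, ¬ Tendsto (fun n => y n ω) atTop (𝓝 0) := by
  set A : ℕ → Set Ω := fun m =>
    {ω | Tendsto (fun n => y n ω) atTop (𝓝 0) ∧ ∀ j, m ≤ j → |y j ω| < δ} with hA
  have hnull : ∀ m, ∀ᵐ ω ∂P, ω ∉ A m := by
    intro m
    obtain ⟨q, hq1, hq⟩ := h.measureReal_inter_le hc hC hγ hsum hδ m
    have hsup : ∀ n, ℱ n ≤ ⨆ n, ℱ n := fun n => le_iSup (fun n => (ℱ n : MeasurableSpace Ω)) n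
    have hsle : (⨆ n, ℱ n : MeasurableSpace Ω) ≤ m0 := iSup_le ℱ.le
    have hAm : MeasurableSet[⨆ n, ℱ n] (A m) := by
      have hym : ∀ n, Measurable[⨆ n, ℱ n] (y n) := fun n => (h.measurable n).mono (hsup n) le_rfl
      have e : A m = {ω | Tendsto (fun n => y n ω) atTop (𝓝 0)} ∩
          ⋂ j, ⋂ (_ : m ≤ j), (y j) ⁻¹' Set.Ioo (-δ) δ := by
        ext ω; simp [hA, abs_lt]
      rw [e]
      exact (@measurableSet_tendsto _ _ _ (⨆ n, ℱ n) _ _ _ _ (𝓝 (0 : ℝ)) _ _ _ hym).inter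
        (MeasurableSet.iInter fun j => MeasurableSet.iInter fun _ => hym j measurableSet_Ioo)
    set f : Ω → ℝ := (A m).indicator fun _ => 1 with hf
    have hfi : Integrable f P := (integrable_const 1).indicator (hsle _ hAm)
    have hfm : P[f | ⨆ n, ℱ n] = f :=
      condExp_of_stronglyMeasurable hsle (stronglyMeasurable_const.indicator hAm) hfi
    -- Lévy's upward theorem: the conditional probabilities of `A m` tend to its indicator, hence to
    -- `1` on `A m`, yet they are eventually at most `max q 0 < 1`.
    have hlim := tendsto_ae_condExp (ℱ := ℱ) (μ := P) f
    have hle : ∀ᵐ ω ∂P, ∀ᶠ n in atTop, (P[f | ℱ n]) ω ≤ max q 0 := by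
      obtain ⟨N, hN⟩ := eventually_atTop.1 hq
      have : ∀ n, ∀ᵐ ω ∂P, N ≤ n → (P[f | ℱ n]) ω ≤ max q 0 := by
        intro n
        by_cases hn : N ≤ n
        · simp only [hn, true_imp_iff]
          by_contra hcon
          have hpos : P {ω | max q 0 < (P[f | ℱ n]) ω} ≠ 0 := by
            intro h0
            apply hcon
            rw [ae_iff]
            simpa using h0
          have hG : MeasurableSet[ℱ n] {ω | max q 0 < (P[f | ℱ n]) ω} :=
            stronglyMeasurable_condExp.measurable measurableSet_Ioi
          -- The comparison of integrals needs a nonnegative threshold, hence `max q 0` in place of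
          -- `q`.
          have h1 := setIntegral_gt_gt (le_max_right q 0) integrable_condExp.integrableOn hpos
          rw [setIntegral_condExp (ℱ.le n) hfi hG, hf,
            setIntegral_indicator (hsle _ hAm)] at h1
          have h2 := hN n hn _ hG
          rw [Set.inter_comm] at h2
          simp only [integral_const, smul_eq_mul, mul_one, measureReal_restrict_apply_univ] at h1
          have h3 := mul_le_mul_of_nonneg_right (le_max_left q 0)
            (measureReal_nonneg (μ := P) (s := {ω | max q 0 < (P[f | ℱ n]) ω}))
          linarith
        · simp [hn]
      filter_upwards [ae_all_iff.2 this] with ω hω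
      exact eventually_atTop.2 ⟨N, hω⟩
    filter_upwards [hlim, hle] with ω h1 h2 hmem
    rw [hfm] at h1
    have := le_of_tendsto h1 h2
    simp only [hf, Set.indicator_of_mem hmem] at this
    exact absurd this (not_le.2 (max_lt hq1 one_pos))
  filter_upwards [ae_all_iff.2 hnull] with ω hω hlim
  obtain ⟨m, hm⟩ := eventually_atTop.1 (hlim.eventually (Metric.ball_mem_nhds 0 hδ))
  exact hω m ⟨hlim, fun j hj => by simpa using hm j hj⟩

end IsRepelled

lemma IsBoundedNoise.ae_exists_tendsto_sum {Ω : Type*} {m0 : MeasurableSpace Ω} {P : Measure Ω}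
    [IsProbabilityMeasure P] {ℱ : Filtration ℕ m0} {γ : ℕ → ℝ} {C c : ℝ} {ζ : ℕ → Ω → ℝ}
    (h : IsBoundedNoise P ℱ γ C c ζ) (hsum : Summable fun n => γ n ^ 2) :
    ∀ᵐ ω ∂P, ∃ L, Tendsto (fun n => ∑ i ∈ Finset.range n, ζ i ω) atTop (𝓝 L) := by
  set M : ℕ → Ω → ℝ := fun n ω => ∑ i ∈ Finset.range n, ζ i ω with hM
  have hMm : ∀ n, Measurable[ℱ n] (M n) := fun n =>
    Finset.measurable_sum _ fun i hi =>
      (h.measurable i).mono (ℱ.mono (Finset.mem_range.1 hi)) le_rfl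
  have hMb : ∀ n ω, |M n ω| ≤ ∑ i ∈ Finset.range n, C * γ i := fun n ω =>
    (Finset.abs_sum_le_sum_abs _ _).trans (Finset.sum_le_sum fun i _ => h.bound i ω)
  have hMi : ∀ n, Integrable (M n) P := fun n =>
    integrable_of_abs_le ((hMm n).mono (ℱ.le n) le_rfl) (hMb n)
  have hmart : Martingale M ℱ P := by
    refine martingale_of_condExp_sub_eq_zero_nat (fun n => (hMm n).stronglyMeasurable) hMi
      fun n => ?_
    have e : M (n + 1) - M n = ζ n := by
      ext ω
      simp [hM, Finset.sum_range_succ]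
    rw [e]
    exact h.condExp_eq_zero n
  have hbd : ∀ n, ∫ ω, |M n ω| ∂P ≤ 1 + C ^ 2 * ∑' i, γ i ^ 2 := by
    intro n
    -- No stopping and no shift: this is the plain L² bound, passed to L¹ through `|x| ≤ 1 + x ^ 2`.
    have h1 := h.setIntegral_sq_sum_le 0 (fun _ => Set.univ) (fun _ => MeasurableSet.univ)
      (H := Set.univ) MeasurableSet.univ 0 n
    simp only [Set.indicator_univ, zero_add, sub_zero, Measure.restrict_univ, probReal_univ,
      mul_one, ne_eq, OfNat.ofNat_ne_zero, not_false_eq_true, zero_pow] at h1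
    have h2 : ∑ i ∈ Finset.range n, γ i ^ 2 ≤ ∑' i, γ i ^ 2 :=
      hsum.sum_le_tsum _ fun i _ => sq_nonneg _
    have hi2 : Integrable (fun ω => M n ω ^ 2) P :=
      integrable_of_abs_le (K := (∑ i ∈ Finset.range n, C * γ i) ^ 2)
        (((hMm n).mono (ℱ.le n) le_rfl).pow_const 2) fun ω => by
          rw [abs_pow]; exact pow_le_pow_left₀ (abs_nonneg _) (hMb n ω) 2
    calc ∫ ω, |M n ω| ∂P ≤ ∫ ω, (1 + M n ω ^ 2) ∂P := by
          refine integral_mono (hMi n).abs ((integrable_const 1).add hi2) fun ω => ?_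
          change |M n ω| ≤ 1 + M n ω ^ 2
          rw [← sq_abs]
          nlinarith [sq_nonneg (|M n ω| - 1), abs_nonneg (M n ω)]
      _ = 1 + ∫ ω, M n ω ^ 2 ∂P := by
          rw [integral_add (integrable_const 1) hi2]; simp
      _ ≤ _ := by
          have h3 := mul_le_mul_of_nonneg_left h2 (sq_nonneg C)
          linarith [h1.trans h3]
  refine hmart.submartingale.exists_ae_tendsto_of_bdd
    (R := (1 + C ^ 2 * ∑' i, γ i ^ 2).toNNReal) fun n => ?_
  rw [eLpNorm_one_eq_lintegral_enorm, ← ofReal_integral_norm_eq_lintegral_enorm (hMi n)]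
  exact ENNReal.ofReal_le_ofReal (hbd n)

/-! ### Step sizes: positive, square-summable, vanishing, with divergent sum -/

section StepSize

variable {η α : ℝ}

lemma stepSize_pos (hη : 0 < η) (n : ℕ) : 0 < stepSize η α n := by
  unfold stepSize; positivity

lemma summable_stepSize_sq (hα : 1 / 2 < α) : Summable fun n => stepSize η α n ^ 2 := by
  have h := (Real.summable_one_div_nat_add_rpow 1 (α * 2)).2 (by linarith)
  refine (h.mul_left (η ^ 2)).congr fun n => ?_
  have hn : (0 : ℝ) ≤ (n : ℝ) + 1 := by positivity
  rw [stepSize, div_pow, abs_of_nonneg hn, Real.rpow_mul hn, mul_one_div]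
  norm_cast

lemma tendsto_stepSize (hα : 0 < α) : Tendsto (stepSize η α) atTop (𝓝 0) := by
  have h : Tendsto (fun n : ℕ => ((n : ℝ) + 1) ^ α) atTop atTop :=
    (tendsto_rpow_atTop hα).comp (tendsto_atTop_add_const_right _ _ tendsto_natCast_atTop_atTop)
  exact h.const_div_atTop η

lemma tendsto_sum_stepSize (hη : 0 < η) (hα : α ≤ 1) :
    Tendsto (fun n => ∑ k ∈ Finset.range n, stepSize η α k) atTop atTop := by
  refine (not_summable_iff_tendsto_nat_atTop_of_nonneg fun n => (stepSize_pos hη n).le).1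
    fun h => ?_
  have h1 : Summable fun n : ℕ => 1 / |(n : ℝ) + 1| ^ α := by
    refine (h.mul_left η⁻¹).congr fun n => ?_
    have hn : (0 : ℝ) ≤ (n : ℝ) + 1 := by positivity
    rw [stepSize, abs_of_nonneg hn]
    field_simp
  linarith [(Real.summable_one_div_nat_add_rpow 1 α).1 h1]

end StepSize

instance : DiscreteMeasurableSpace Price := ⟨fun _ => trivial⟩

/-! ### From the conditional batch law to martingale noise -/

section Feedback

variable {Ω : Type*} {m0 : MeasurableSpace Ω} {P : Measure Ω} {b : ℕ} {ρ r η α θ₀ : ℝ}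
  {S : ℕ → Ω → Fin b → Fin 2 → Price}

lemma measurable_batchEstimator_sigmoid (x : Fin b → Fin 2 → Price) :
    Measurable fun z => batchEstimator ρ r (Real.sigmoid z) x := by
  have hσ := continuous_sigmoid.measurable
  have hm : ∀ a, Measurable fun z => marginalProb ρ (Real.sigmoid z) a := by
    intro a
    cases a
    · simp only [marginalProb_H]; fun_prop
    · simp only [marginalProb_L]; fun_prop
  unfold batchEstimator ipwEstimator
  refine Measurable.const_mul (Finset.measurable_sum _ fun l _ =>
    Finset.measurable_sum _ fun i _ => ?_) _
  exact (((hm .H).const_div _).mul_const _).sub (((hm .L).const_div _).mul_const _)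

/-- A batch takes finitely many values, so conditioning on the history reduces to the indicators
whose conditional law is given. -/
lemma eq_sum_indicator (f : ℝ → (Fin b → Fin 2 → Price) → ℝ) (Z : Ω → ℝ)
    (X : Ω → Fin b → Fin 2 → Price) (ω : Ω) :
    f (Z ω) (X ω) = ∑ x, f (Z ω) x * (X ⁻¹' {x}).indicator (fun _ => (1 : ℝ)) ω := by
  rw [Finset.sum_eq_single (X ω)]
  · simp
  · intro x _ hx
    simp [Ne.symm hx]
  · simp

lemma measurable_comp_batch {f : ℝ → (Fin b → Fin 2 → Price) → ℝ} (hf : ∀ x, Measurable (f · x))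
    {Z : Ω → ℝ} (hZ : Measurable Z) {X : Ω → Fin b → Fin 2 → Price} (hX : Measurable X) :
    Measurable fun ω => f (Z ω) (X ω) := by
  simp_rw [eq_sum_indicator f Z X]
  exact Finset.measurable_sum _ fun x _ => ((hf x).comp hZ).mul
    (measurable_const.indicator (hX (measurableSet_singleton x)))

lemma measurable_logOdds (hS : ∀ n, Measurable (S n)) (n : ℕ) :
    Measurable fun ω => logOdds ρ r η α θ₀ (fun j => S j ω) n := by
  induction n with
  | zero => exact measurable_const
  | succ n ih =>
    exact ih.add ((measurable_comp_batch measurable_batchEstimator_sigmoid ih (hS n)).const_mul _)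

/-- The histories `ℋ_n` as a filtration. -/
noncomputable def historyFiltration (ρ r η α θ₀ : ℝ) (hS : ∀ n, Measurable (S n)) : Filtration ℕ m0 where
  seq n := history ρ r η α θ₀ S n
  mono' _ _ hmn := biSup_mono fun _ hk => le_trans hk hmn
  le' _ := iSup₂_le fun k _ => (measurable_logOdds hS k).comap_le

lemma measurable_logOdds_history (hS : ∀ n, Measurable (S n)) (n : ℕ) :
    Measurable[historyFiltration ρ r η α θ₀ hS n]
      fun ω => logOdds ρ r η α θ₀ (fun j => S j ω) n :=
  measurable_iff_comap_le.2 (le_iSup₂_of_le (f := fun k (_ : k ∈ Set.Iic n) =>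
    MeasurableSpace.comap (fun ω => logOdds ρ r η α θ₀ (fun j => S j ω) k) inferInstance)
    n (Set.mem_Iic.2 le_rfl) le_rfl)

/-- Conditional expectation of a function of the log-odds and the next batch. -/
lemma condExp_comp_batch [IsProbabilityMeasure P] (hS : IsFeedbackProcess P ρ r η α θ₀ S) (n : ℕ)
    {f : ℝ → (Fin b → Fin 2 → Price) → ℝ} (hf : ∀ x, Measurable (f · x)) {K : ℝ}
    (hK : ∀ z x, |f z x| ≤ K) :
    P[fun ω => f (logOdds ρ r η α θ₀ (fun j => S j ω) n) (S n ω) |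
        historyFiltration ρ r η α θ₀ hS.measurable n] =ᵐ[P]
      fun ω => ∑ x, batchProb ρ (propensity ρ r η α θ₀ (fun j => S j ω) n) x *
        f (logOdds ρ r η α θ₀ (fun j => S j ω) n) x := by
  set ℱ := historyFiltration ρ r η α θ₀ hS.measurable
  set Z : Ω → ℝ := fun ω => logOdds ρ r η α θ₀ (fun j => S j ω) n with hZ
  have hZm : Measurable[ℱ n] Z := measurable_logOdds_history hS.measurable n
  have hZ0 : Measurable Z := hZm.mono (ℱ.le n) le_rfl
  have hset : ∀ x, MeasurableSet (S n ⁻¹' {x}) := fun x =>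
    hS.measurable n (measurableSet_singleton x)
  have hind : ∀ x, Integrable ((S n ⁻¹' {x}).indicator fun _ => (1 : ℝ)) P := fun x =>
    (integrable_const 1).indicator (hset x)
  have e : (fun ω => f (Z ω) (S n ω)) =
      ∑ x, (fun ω => f (Z ω) x) * (S n ⁻¹' {x}).indicator (fun _ => (1 : ℝ)) := by
    ext ω
    rw [eq_sum_indicator f Z (S n) ω, Finset.sum_apply]
    rfl
  have hmul : ∀ x, Integrable
      ((fun ω => f (Z ω) x) * (S n ⁻¹' {x}).indicator (fun _ => (1 : ℝ))) P := fun x => by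
    refine integrable_of_abs_le (K := K) (((hf x).comp hZ0).mul
      (measurable_const.indicator (hset x))) fun ω => ?_
    have h0 := hK (Z ω) x
    by_cases hω : ω ∈ S n ⁻¹' {x}
    · simpa [Set.indicator_of_mem hω] using h0
    · simpa [Set.indicator_of_notMem hω] using (abs_nonneg _).trans h0
  rw [e]
  have h1 := condExp_finsetSum (μ := P) (s := Finset.univ) (fun x _ => hmul x) (ℱ n)
  have h2 : ∀ x, P[(fun ω => f (Z ω) x) * (S n ⁻¹' {x}).indicator (fun _ => (1 : ℝ)) | ℱ n] =ᵐ[P]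
      fun ω => f (Z ω) x * batchProb ρ (propensity ρ r η α θ₀ (fun j => S j ω) n) x := by
    intro x
    have h3 := condExp_mul_of_stronglyMeasurable_left (μ := P) (m := ℱ n)
      ((hf x).comp hZm).stronglyMeasurable (hmul x) (hind x)
    filter_upwards [h3, hS.condLaw n x] with ω e1 e2
    have e3 : (P[(S n ⁻¹' {x}).indicator (fun _ => (1 : ℝ)) | ℱ n]) ω =
      ∏ l : Fin b, profileProb ρ (propensity ρ r η α θ₀ (fun j => S j ω) n) (x l) := e2
    exact e1.trans (congrArg (f (Z ω) x * ·) e3)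
  filter_upwards [h1, ae_all_iff.2 h2] with ω e1 e2
  rw [e1, Finset.sum_apply]
  exact Finset.sum_congr rfl fun x _ => (e2 x).trans (mul_comm _ _)

/-- The noise in the log-odds recursion. -/
lemma isBoundedNoise_logOdds [IsProbabilityMeasure P] (hr : r ∈ Set.Ioo (1 : ℝ) 2)
    (hρ : ρ ∈ Set.Ioo (1 / 2 : ℝ) 1) (hb : 1 ≤ b) (hη : 0 < η)
    (hS : IsFeedbackProcess P ρ r η α θ₀ S) :
    IsBoundedNoise P (historyFiltration ρ r η α θ₀ hS.measurable) (stepSize η α) (8 / (1 - ρ))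
      (8 * ((1 - ρ) ^ 2) ^ b) (fun n ω => logOdds ρ r η α θ₀ (fun j => S j ω) (n + 1) -
        logOdds ρ r η α θ₀ (fun j => S j ω) n -
        stepSize η α n * payoffDiff ρ r (propensity ρ r η α θ₀ (fun j => S j ω) n)) := by
  set ℱ := historyFiltration ρ r η α θ₀ hS.measurable
  set f : ℕ → ℝ → (Fin b → Fin 2 → Price) → ℝ := fun n z x =>
    stepSize η α n * (batchEstimator ρ r (Real.sigmoid z) x - payoffDiff ρ r (Real.sigmoid z))
    with hfdef
  have hcont : Continuous fun z => payoffDiff ρ r (Real.sigmoid z) :=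
    (continuousOn_payoffDiff hρ).comp_continuous continuous_sigmoid sigmoid_mem_Icc
  have hfm : ∀ n x, Measurable (f n · x) := fun n x =>
    ((measurable_batchEstimator_sigmoid x).sub hcont.measurable).const_mul _
  have hfb : ∀ n z x, |f n z x| ≤ 8 / (1 - ρ) * stepSize η α n := by
    intro n z x
    have h1 := abs_batchEstimator_le hr hρ hb (sigmoid_mem_Icc z) x
    have h2 := abs_payoffDiff_le hr hρ (sigmoid_mem_Icc z)
    rw [hfdef, abs_mul, abs_of_pos (stepSize_pos hη n), mul_comm]
    refine mul_le_mul_of_nonneg_right ((abs_sub _ _).trans ?_) (stepSize_pos hη n).le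
    have : 8 / (1 - ρ) = 4 / (1 - ρ) + 4 / (1 - ρ) := by ring
    linarith
  have hζ : ∀ n ω, logOdds ρ r η α θ₀ (fun j => S j ω) (n + 1) -
        logOdds ρ r η α θ₀ (fun j => S j ω) n -
        stepSize η α n * payoffDiff ρ r (propensity ρ r η α θ₀ (fun j => S j ω) n) =
      f n (logOdds ρ r η α θ₀ (fun j => S j ω) n) (S n ω) := by
    intro n ω
    simp only [hfdef, logOdds, propensity]
    ring
  refine ⟨fun n => ?_, fun n ω => ?_, fun n => ?_, fun n => ?_⟩
  -- The history is generated by the log-odds, not by the batches, so adaptedness is read off the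
  -- increment of `z`, not from `S n`.
  · have hm := (measurable_logOdds_history (ρ := ρ) (r := r) (η := η) (α := α) (θ₀ := θ₀)
      hS.measurable n).mono (ℱ.mono (Nat.le_succ n)) le_rfl
    exact ((measurable_logOdds_history hS.measurable (n + 1)).sub hm).sub
      ((hcont.measurable.comp hm).const_mul _)
  · rw [hζ]; exact hfb n _ _
  · simp_rw [hζ]
    refine (condExp_comp_batch hS n (hfm n) (hfb n)).trans (ae_of_all _ fun ω => ?_)
    have h1 := sum_batchProb_mul_batchEstimator (r := r) hρ hb
      (sigmoid_mem_Icc (logOdds ρ r η α θ₀ (fun j => S j ω) n))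
    have h2 := sum_batchProb (b := b) ρ (Real.sigmoid (logOdds ρ r η α θ₀ (fun j => S j ω) n))
    simp only [hfdef, propensity, mul_left_comm _ (stepSize η α n), ← Finset.mul_sum, mul_sub,
      Finset.sum_sub_distrib, ← Finset.sum_mul, h1, h2]
    simp
  · simp_rw [hζ]
    have hsqm : ∀ x, Measurable fun z => f n z x ^ 2 := fun x => (hfm n x).pow_const 2
    have hsqb : ∀ z x, |f n z x ^ 2| ≤ (8 / (1 - ρ) * stepSize η α n) ^ 2 := fun z x => by
      rw [abs_pow]; exact pow_le_pow_left₀ (abs_nonneg _) (hfb n z x) 2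
    filter_upwards [condExp_comp_batch hS n (f := fun z x => f n z x ^ 2) hsqm hsqb] with ω hω
    rw [hω]
    have h1 := le_sum_batchProb_mul_sq (b := b) hr hρ hb
      (sigmoid_mem_Icc (logOdds ρ r η α θ₀ (fun j => S j ω) n))
      (payoffDiff ρ r (Real.sigmoid (logOdds ρ r η α θ₀ (fun j => S j ω) n)))
    simp only [hfdef, propensity, mul_pow, mul_left_comm _ (stepSize η α n ^ 2), ← Finset.mul_sum]
    rw [mul_comm]
    exact mul_le_mul_of_nonneg_left h1 (sq_nonneg _)

end Feedback

/-! ### Zeros of `Δ` -/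

section Equilibria

variable {ρ r : ℝ}

lemma payoffDiff_eq_zero_iff (hr : r ∈ Set.Ioo (1 : ℝ) 2) (hρ : ρ ∈ Set.Ioo (1 / 2 : ℝ) 1) {θ : ℝ}
    (hθ : θ ∈ Set.Icc (0 : ℝ) 1) :
    payoffDiff ρ r θ = 0 ↔ θ * (1 - θ) = fidelityStat ρ r / 4 := by
  obtain ⟨κ, hκ, e⟩ := payoffDiff_factor hr hρ hθ
  rw [e, mul_eq_zero, or_iff_right hκ.ne', sub_eq_zero]

lemma exists_payoffDiff_ne_zero (hr : r ∈ Set.Ioo (1 : ℝ) 2) (hρ : ρ ∈ Set.Ioo (1 / 2 : ℝ) 1)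
    {s t : ℝ} (hs : 0 < s) (hst : s < t) (ht : t < 1) :
    ∃ x ∈ Set.Ioo s t, payoffDiff ρ r x ≠ 0 := by
  by_contra! hall
  have key : ∀ x ∈ Set.Ioo s t, x * (1 - x) = fidelityStat ρ r / 4 := fun x hx =>
    (payoffDiff_eq_zero_iff hr hρ ⟨by linarith [hx.1], by linarith [hx.2]⟩).1 (hall x hx)
  -- A second difference at three equally spaced points detects the curvature of `x * (1 - x)`.
  have k1 := key ((3 * s + t) / 4) ⟨by linarith, by linarith⟩
  have k2 := key ((2 * s + 2 * t) / 4) ⟨by linarith, by linarith⟩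
  have k3 := key ((s + 3 * t) / 4) ⟨by linarith, by linarith⟩
  have : (t - s) ^ 2 = 0 := by linear_combination (-8) * k1 + 16 * k2 - 8 * k3
  have : t - s = 0 := by simpa using this
  linarith

lemma payoffDiff_one_neg (hr : r ∈ Set.Ioo (1 : ℝ) 2) (hρ : ρ ∈ Set.Ioo (1 / 2 : ℝ) 1) :
    payoffDiff ρ r 1 < 0 := by
  obtain ⟨κ, hκ, e⟩ := payoffDiff_factor hr hρ (θ := 1) ⟨zero_le_one, le_rfl⟩
  rw [e]
  nlinarith [fidelityStat_pos hr hρ]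

lemma sub_thetaMinus_mul (hs : fidelityStat ρ r ≤ 1) (θ : ℝ) :
    (θ - thetaMinus ρ r) * (thetaPlus ρ r - θ) = θ * (1 - θ) - fidelityStat ρ r / 4 := by
  have := Real.sq_sqrt (sub_nonneg.2 hs)
  unfold thetaMinus thetaPlus
  linear_combination (1 / 4) * this

lemma thetaMinus_pos (hr : r ∈ Set.Ioo (1 : ℝ) 2) (hρ : ρ ∈ Set.Ioo (1 / 2 : ℝ) 1) :
    0 < thetaMinus ρ r := by
  have h := fidelityStat_pos hr hρ
  have : Real.sqrt (1 - fidelityStat ρ r) < 1 := by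
    rw [Real.sqrt_lt' one_pos]; linarith
  unfold thetaMinus
  linarith

lemma thetaMinus_lt_thetaPlus (hs : fidelityStat ρ r < 1) : thetaMinus ρ r < thetaPlus ρ r := by
  have := Real.sqrt_pos.2 (sub_pos.2 hs)
  unfold thetaMinus thetaPlus
  linarith

lemma thetaPlus_lt_one (hr : r ∈ Set.Ioo (1 : ℝ) 2) (hρ : ρ ∈ Set.Ioo (1 / 2 : ℝ) 1) :
    thetaPlus ρ r < 1 := by
  have h := thetaMinus_pos hr hρ
  unfold thetaMinus at h
  unfold thetaPlus
  linarith

end Equilibria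

/-- The repelling equilibrium `θ₋` is almost surely not a limit. -/
theorem ae_not_tendsto_thetaMinus {Ω : Type*} {m0 : MeasurableSpace Ω} {P : Measure Ω}
    [IsProbabilityMeasure P] {b : ℕ} {ρ r η α θ₀ : ℝ} {S : ℕ → Ω → Fin b → Fin 2 → Price}
    (hr : r ∈ Set.Ioo (1 : ℝ) 2) (hρ : ρ ∈ Set.Ioo (1 / 2 : ℝ) 1) (hb : 1 ≤ b) (hη : 0 < η)
    (hα : 1 / 2 < α) (hS : IsFeedbackProcess P ρ r η α θ₀ S) (hs : fidelityStat ρ r < 1) :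
    ∀ᵐ ω ∂P, ¬ Tendsto (fun n => propensity ρ r η α θ₀ (fun j => S j ω) n) atTop
      (𝓝 (thetaMinus ρ r)) := by
  have hlt := thetaMinus_lt_thetaPlus hs
  have h0 := thetaMinus_pos hr hρ
  have h1 := thetaPlus_lt_one hr hρ
  have hρ1 : 0 < 1 - ρ := by linarith [hρ.2]
  obtain ⟨z₁, hz₁⟩ := exists_sigmoid_eq ⟨h0, hlt.trans h1⟩
  obtain ⟨z₂, hz₂⟩ := exists_sigmoid_eq ⟨h0.trans hlt, h1⟩
  have hz : z₁ < z₂ := by rw [← Real.sigmoid_lt_iff, hz₁, hz₂]; exact hlt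
  have hcont : Continuous fun z => payoffDiff ρ r (Real.sigmoid z) :=
    (continuousOn_payoffDiff hρ).comp_continuous continuous_sigmoid sigmoid_mem_Icc
  -- The radius `z₂ - z₁` stops at the log-odds of `θ₊`. Below it, `Δ` has the sign of `θ - θ₋`, on
  -- both sides of `θ₋`.
  have hrep : IsRepelled P (historyFiltration ρ r η α θ₀ hS.measurable) (stepSize η α)
      (8 / (1 - ρ)) (8 * ((1 - ρ) ^ 2) ^ b) (z₂ - z₁)
      (fun n ω => logOdds ρ r η α θ₀ (fun j => S j ω) n - z₁)
      (fun n ω => stepSize η α n *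
        payoffDiff ρ r (propensity ρ r η α θ₀ (fun j => S j ω) n)) := by
    refine ⟨?_, fun n => ?_, fun n => ?_, fun n ω => ?_, fun n ω hn => ?_⟩
    · simpa only [sub_sub_sub_cancel_right] using isBoundedNoise_logOdds hr hρ hb hη hS
    · exact (measurable_logOdds_history hS.measurable n).sub_const _
    · exact (hcont.measurable.comp (measurable_logOdds_history hS.measurable n)).const_mul _
    · rw [abs_mul, abs_of_pos (stepSize_pos hη n), mul_comm]
      refine mul_le_mul_of_nonneg_right ((abs_payoffDiff_le hr hρ (sigmoid_mem_Icc _)).trans ?_)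
        (stepSize_pos hη n).le
      gcongr
      norm_num
    · set z := logOdds ρ r η α θ₀ (fun j => S j ω) n with hzdef
      obtain ⟨κ, hκ, e⟩ := payoffDiff_factor hr hρ (sigmoid_mem_Icc z)
      have hγ := stepSize_pos (α := α) hη n
      have hz2 : Real.sigmoid z < thetaPlus ρ r := by
        rw [← hz₂]; exact Real.sigmoid_lt (by linarith [(abs_lt.1 hn).2])
      have hsign : 0 ≤ (z - z₁) * (Real.sigmoid z - thetaMinus ρ r) := by
        rw [← hz₁]
        rcases le_total z₁ z with hle | hle
        · exact mul_nonneg (by linarith) (by linarith [Real.sigmoid_le hle])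
        · exact mul_nonneg_of_nonpos_of_nonpos (by linarith) (by linarith [Real.sigmoid_le hle])
      have hprod := mul_nonneg (mul_nonneg hγ.le hκ.le)
        (mul_nonneg hsign (sub_nonneg.2 hz2.le))
      have e2 : payoffDiff ρ r (propensity ρ r η α θ₀ (fun j => S j ω) n) =
          κ * ((Real.sigmoid z - thetaMinus ρ r) * (thetaPlus ρ r - Real.sigmoid z)) := by
        rw [sub_thetaMinus_mul hs.le]; exact e
      rw [e2]
      refine hprod.trans_eq ?_
      ring
  have := hrep.ae_not_tendsto_zero (by positivity) (by positivity) (stepSize_pos hη)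
    (summable_stepSize_sq hα) (sub_pos.2 hz)
  filter_upwards [this] with ω hω hlim
  apply hω
  have h2 : Tendsto (fun n => logOdds ρ r η α θ₀ (fun j => S j ω) n) atTop (𝓝 z₁) :=
    tendsto_of_tendsto_sigmoid (by rw [hz₁]; exact hlim)
  simpa using h2.sub_const z₁

/-- The propensity converges almost surely, to `0` or to an interior equilibrium. -/
theorem ae_exists_tendsto_propensity {Ω : Type*} {m0 : MeasurableSpace Ω} {P : Measure Ω}
    [IsProbabilityMeasure P] {b : ℕ} {ρ r η α θ₀ : ℝ} {S : ℕ → Ω → Fin b → Fin 2 → Price}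
    (hr : r ∈ Set.Ioo (1 : ℝ) 2) (hρ : ρ ∈ Set.Ioo (1 / 2 : ℝ) 1) (hb : 1 ≤ b) (hη : 0 < η)
    (hα : α ∈ Set.Ioc (1 / 2 : ℝ) 1) (hS : IsFeedbackProcess P ρ r η α θ₀ S) :
    ∀ᵐ ω ∂P, ∃ θ, Tendsto (fun n => propensity ρ r η α θ₀ (fun j => S j ω) n) atTop (𝓝 θ) ∧
      (θ = 0 ∨ θ ∈ Set.Ioo (0 : ℝ) 1 ∧ payoffDiff ρ r θ = 0) := by
  filter_upwards [(isBoundedNoise_logOdds hr hρ hb hη hS).ae_exists_tendsto_sum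
    (summable_stepSize_sq hα.1)] with ω hω
  -- Here `N` is the sequence of partial sums of the noise, which converges along this path.
  refine exists_tendsto_sigmoid (G := payoffDiff ρ r) (C := 4 / (1 - ρ)) (fun n => ?_) hω
    (fun n => (stepSize_pos hη n).le) (tendsto_stepSize (by linarith [hα.1]))
    (tendsto_sum_stepSize hη hα.2) (continuousOn_payoffDiff hρ)
    (fun t ht => abs_payoffDiff_le hr hρ ht) (payoffDiff_one_neg hr hρ)
    (fun s t hs hst ht => exists_payoffDiff_ne_zero hr hρ hs hst ht)
  rw [Finset.sum_range_succ, propensity]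
  ring

end LLMPricing

/-! ### The three regimes of `ρ` -/

open LLMPricing
theorem mainTheorem3 {Ω : Type*} [MeasurableSpace Ω] (P : Measure Ω) [IsProbabilityMeasure P]
    (r ρ η α θ₀ : ℝ) (b : ℕ)
    (hr : r ∈ Set.Ioo (1 : ℝ) 2) (hρ : ρ ∈ Set.Ioo (1 / 2 : ℝ) 1) (hb : 1 ≤ b)
    (hα : α ∈ Set.Ioc (1 / 2 : ℝ) 1) (hη : η ∈ Set.Ioc (0 : ℝ) 1)
    (hθ₀ : θ₀ ∈ Set.Ioo (0 : ℝ) 1)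
    (S : ℕ → Ω → Fin b → Fin 2 → Price) (hS : IsFeedbackProcess P ρ r η α θ₀ S) :
    ∃ θlim : Ω → ℝ, Measurable θlim ∧
      (∀ᵐ ω ∂P, Tendsto (fun n => propensity ρ r η α θ₀ (fun j => S j ω) n) atTop
        (𝓝 (θlim ω))) ∧
      (∀ᵐ ω ∂P, IsEquilibrium ρ r (θlim ω)) ∧
      (ρ < criticalFidelity r → ∀ᵐ ω ∂P, θlim ω = 0) ∧
      (ρ = criticalFidelity r → ∀ᵐ ω ∂P, θlim ω = 0 ∨ θlim ω = 1 / 2) ∧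
      (criticalFidelity r < ρ →
        (∀ᵐ ω ∂P, θlim ω = 0 ∨ θlim ω = thetaPlus ρ r) ∧
        (∀ᵐ ω ∂P, ¬ Tendsto (fun n => propensity ρ r η α θ₀ (fun j => S j ω) n) atTop (𝓝 1)) ∧
        (∀ᵐ ω ∂P, ¬ Tendsto (fun n => propensity ρ r η α θ₀ (fun j => S j ω) n) atTop
          (𝓝 (thetaMinus ρ r)))) := by
  have hconv := ae_exists_tendsto_propensity hr hρ hb hη.1 hα hS
  obtain ⟨θlim, hmeas, hlim⟩ := measurable_limit_of_tendsto_metrizable_ae (μ := P) (L := atTop)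
    (f := fun n ω => propensity ρ r η α θ₀ (fun j => S j ω) n)
    (fun n => (continuous_sigmoid.measurable.comp (measurable_logOdds hS.measurable n)).aemeasurable)
    (hconv.mono fun ω ⟨θ, h, _⟩ => ⟨θ, h⟩)
  have hzero : ∀ᵐ ω ∂P, θlim ω = 0 ∨ θlim ω ∈ Set.Ioo (0 : ℝ) 1 ∧
      θlim ω * (1 - θlim ω) = fidelityStat ρ r / 4 := by
    filter_upwards [hconv, hlim] with ω ⟨θ, h1, h2⟩ h3
    rw [tendsto_nhds_unique h3 h1]
    exact h2.imp_right fun ⟨hI, h⟩ =>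
      ⟨hI, (payoffDiff_eq_zero_iff hr hρ (Set.Ioo_subset_Icc_self hI)).1 h⟩
  obtain ⟨hsub, hcrit, hsup⟩ := fidelityStat_compare hr hρ
  refine ⟨θlim, hmeas, hlim, ?_, fun h => ?_, fun h => ?_, fun h => ⟨?_, ?_, ?_⟩⟩
  · filter_upwards [hzero] with ω hω
    rcases hω with h0 | ⟨hI, h⟩
    · rw [h0]
      exact ⟨⟨le_rfl, zero_le_one⟩, by simp [odeField]⟩
    · have hI' := Set.Ioo_subset_Icc_self hI
      exact ⟨hI', by rw [odeField, (payoffDiff_eq_zero_iff hr hρ hI').2 h, mul_zero]⟩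
  · filter_upwards [hzero] with ω hω
    refine hω.resolve_right fun ⟨_, h2⟩ => ?_
    -- An interior zero would need `s / 4 ≤ 1 / 4`, the maximum of `θ * (1 - θ)`, against `s > 1`.
    nlinarith [hsub h, sq_nonneg (θlim ω - 1 / 2)]
  · filter_upwards [hzero] with ω hω
    refine hω.imp_right fun ⟨_, h2⟩ => ?_
    rw [hcrit h] at h2
    have h3 : (θlim ω - 1 / 2) ^ 2 = 0 := by linear_combination -h2
    have h4 : θlim ω - 1 / 2 = 0 := by simpa using h3
    linarith
  · filter_upwards [hzero, hlim,
      ae_not_tendsto_thetaMinus hr hρ hb hη.1 hα.1 hS (hsup h)] with ω hω h1 h2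
    refine hω.imp_right fun ⟨_, h3⟩ => ?_
    have h4 := sub_thetaMinus_mul (hsup h).le (θlim ω)
    rw [h3, sub_self, mul_eq_zero] at h4
    rcases h4 with h4 | h4
    · exact absurd (sub_eq_zero.1 h4 ▸ h1) h2
    · linarith
  · filter_upwards [hzero, hlim] with ω hω h1 h2
    have h3 := tendsto_nhds_unique h1 h2
    rcases hω with h4 | ⟨h4, _⟩
    · exact zero_ne_one (h4.symm.trans h3)
    · exact h4.2.ne h3
  · exact ae_not_tendsto_thetaMinus hr hρ hb hη.1 hα.1 hS (hsup h)
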